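/- **The game.** Two firms $X,Y$ have products whose qualities are independent and uniform on $[0,1]$. Each firm commits to a test, given by a threshold $\theta\in[0,1]$; a product of quality $s$ passes the test $\theta$ if and only if $s\ge\theta$. A principal observes only the two thresholds and the two outcomes (pass/fail) and selects one firm. She is rational: for all thresholds and outcomes her (possibly randomized) choice minimizes the probability of selecting the product of lower quality; if both firms have the same threshold and the same outcome, she flips a fair coin. Let $0\le a\le b\le 1$, and let both firms be restricted to thresholds in $S=[a,b]$. A (mixed) strategy of a firm is a probability distribution on $[a,b]$ from which it draws its threshold, independently of everything else. A pair $(\mu_X,\mu_Y)$ of strategies is a Bayes–Nash equilibrium if $\mu_X$ maximizes the probability that $X$ is selected, among all strategies of $X$, given $\mu_Y$, and $\mu_Y$ maximizes the probability that $Y$ is selected, among all strategies of $Y$, given $\mu_X$. **Theorem.** There is exactly one Bayes–Nash equilibrium, and it is symmetric, i.e., of the form $(\mu,\mu)$. The distribution $\mu$, with cdf $F(\theta)=\mu((-\infty,\theta])$, is as follows. 1. If $(1-a)b\le\frac12$, then $\mu$ is the point mass at $b$, i.e., both firms deterministically choose $b$. 2. If $(1-a)b>\frac12$, let $$\delta_b=\frac{1-a(1-b)-b(1-a)}{(1-a)\left((1-b)^2+b^2\right)},\qquad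 \kappa=\frac{1-a-2b+4ab-2ab^2}{1-4(1-a)b+2(1-2a)b^2}.$$ Then $a<\kappa\le b$, the mass of $\mu$ at $b$ is $\mu(\{b\})=\delta_b$, and $$F(\theta)=\begin{cases}\dfrac{1}{2(1-a)}\left((1-2a)+\sqrt{a^2+(1-a)^2}\cdot\dfrac{2\theta-1}{\sqrt{\theta^2+(1-\theta)^2}}\right) & \text{for } a\le\theta<\kappa,\\[2mm] 1-\delta_b & \text{for } \kappa\le\theta<b,\\ 1 & \text{for }\theta=b.\end{cases}$$ -/

import Mathlib

open MeasureTheory Set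

namespace ThresholdTests

noncomputable section

/-- Qualities (in quantile space) are uniformly distributed on `[0,1]`. -/
def quality : Measure ℝ := volume.restrict (Icc 0 1)

/-- The qualities of the two products `X`, `Y` are drawn independently. -/
def qualities : Measure (ℝ × ℝ) := quality.prod quality

/-- Outcome of the test with threshold `θ` on a product of quality `s`:
`true` (pass) iff `θ ≤ s`. -/
def outcome (θ s : ℝ) : Bool := decide (θ ≤ s)

/-- A (possibly randomized) selection rule of the principal: `r x y p q` is the probability of
selecting firm `X` when `X` has threshold `x` and outcome `p`, and `Y` has threshold `y` and
outcome `q`. The principal observes nothing else. -/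
abbrev SelectionRule := ℝ → ℝ → Bool → Bool → ℝ

/-- Probability that the thresholds `x`, `y` lead to the outcomes `p`, `q` and that the worse
product is selected, when `X` is selected with probability `c` on seeing these outcomes. -/
def errorProb (x y : ℝ) (p q : Bool) (c : ℝ) : ℝ :=
  c * qualities.real {z | outcome x z.1 = p ∧ outcome y z.2 = q ∧ z.1 < z.2} +
    (1 - c) * qualities.real {z | outcome x z.1 = p ∧ outcome y z.2 = q ∧ z.2 < z.1}

/-- The principal is rational: for all thresholds in `[0,1]` and all outcomes she minimizes the
probability of selecting the worse product; and she flips a fair coin if there is a tie, i.e. if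
both firms have the same threshold and the same outcome. -/
structure IsRational (r : SelectionRule) : Prop where
  mem_Icc : ∀ x y p q, r x y p q ∈ Icc (0 : ℝ) 1
  optimal : ∀ x ∈ Icc (0 : ℝ) 1, ∀ y ∈ Icc (0 : ℝ) 1, ∀ p q, ∀ c ∈ Icc (0 : ℝ) 1,
    errorProb x y p q (r x y p q) ≤ errorProb x y p q c
  tie : ∀ x p, r x x p p = 1 / 2

/-- Probability that firm `X` is selected when the thresholds are `x` (for `X`) and `y`
(for `Y`). -/
def winProb (r : SelectionRule) (x y : ℝ) : ℝ :=
  ∫ z, r x y (outcome x z.1) (outcome y z.2) ∂qualities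

/-- Probability that firm `X` is selected when the thresholds of `X`, `Y` are drawn independently
from `μX`, `μY`. -/
def selectX (r : SelectionRule) (μX μY : ProbabilityMeasure ℝ) : ℝ :=
  ∫ w, winProb r w.1 w.2 ∂((μX : Measure ℝ).prod (μY : Measure ℝ))

/-- Probability that firm `Y` is selected; exactly one firm is selected. -/
def selectY (r : SelectionRule) (μX μY : ProbabilityMeasure ℝ) : ℝ := 1 - selectX r μX μY

/-- Mixed strategies of a firm restricted to thresholds in `S`: probability distributions
concentrated on `S`. -/
def strategies (S : Set ℝ) : Set (ProbabilityMeasure ℝ) := {μ | (μ : Measure ℝ) Sᶜ = 0}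

/-- Bayes–Nash equilibrium of the test selection game with thresholds restricted to `S`: each
firm's distribution maximizes its selection probability among all strategies on `S`, given the
other's distribution. -/
structure IsEquilibrium (r : SelectionRule) (S : Set ℝ) (μX μY : ProbabilityMeasure ℝ) :
    Prop where
  memX : μX ∈ strategies S
  memY : μY ∈ strategies S
  bestX : ∀ μ ∈ strategies S, selectX r μ μY ≤ selectX r μX μY
  bestY : ∀ μ ∈ strategies S, selectY r μX μ ≤ selectY r μX μY

/-- The point mass `δ_b`. -/
def massB (a b : ℝ) : ℝ :=
  (1 - a * (1 - b) - b * (1 - a)) / ((1 - a) * ((1 - b) ^ 2 + b ^ 2))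

/-- The cutoff `κ`. -/
def cutoff (a b : ℝ) : ℝ :=
  (1 - a - 2 * b + 4 * a * b - 2 * a * b ^ 2) /
    (1 - 4 * (1 - a) * b + 2 * (1 - 2 * a) * b ^ 2)

end

end ThresholdTests

/-! ### The rational principal's choice after each pair of outcomes -/

namespace ThresholdTests

/-! A rational principal favours the harder test unless it is failed while the easier one is passed.
So threshold `x` beats `y < x` with probability `1 - x * (1 - y)`, loses to `y > x` except with
probability `y * (1 - x)`, and ties count `1 / 2` (`payoff`). Only the pair of thresholds `0`, `1`
escapes: its outcomes carry no information, the choice there is arbitrary, and it has to be shown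
irrelevant (`AvoidsTrivial`).

The reduced game is symmetric with constant sum 1. Hence a strategy `μ` against which no threshold
wins with probability above `1 / 2` gives an equilibrium `(μ, μ)`, and each component `ν` of any
equilibrium is optimal as well: `ν` and `μ` earn `1 / 2` against each other, so each uses only best
replies to the other. Uniqueness means that these conditions force `ν = μ`.

Write `g = sqSum`, `F` for the cdf of the opponent and `m` for its mean. Away from atoms the payoff
of `x` is `(1 - x) * m + g x * F x - (2 * x - 1) * ∫ t in a..x, F t`. If `(1 - a) * b ≤ 1 / 2`,
undercutting a rival at `b` does not pay. Otherwise, setting the payoff equal to `1 / 2` on `[a, κ)`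
is a linear first-order ODE for the integral of `F`, with homogeneous solution `√g`; at `x = a` it
gives `m = 1 / (2 * (1 - a))`. Indifference at `b` gives the atom, and `κ` is where `F` reaches `1 -
massB a b`. In the gap between `κ` and `b` the payoff is affine and strictly decreasing.

For uniqueness, another optimal `ν` satisfies the same ODE below `κ` and has no mass in the gap. It
then differs from `μ` only through the difference `n` of the means (`meanGap`), with `primGap a ν x
= n * (x - a * √(g x) / √(g a))`. Nonnegativity of the cdf at `a` gives `0 ≤ n`, and the payoff just
above `κ` gives `n ≤ 0`. -/

instance : IsProbabilityMeasure quality :=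
  ⟨by simp [quality]⟩

instance : IsProbabilityMeasure qualities := by
  unfold qualities; infer_instance

theorem quality_real_Ico {s t : ℝ} (hs : 0 ≤ s) (hst : s ≤ t) (ht : t ≤ 1) :
    quality.real (Ico s t) = t - s := by
  rw [quality, measureReal_restrict_apply measurableSet_Ico,
    inter_eq_left.2 (Ico_subset_Icc_self.trans (Icc_subset_Icc hs ht)),
    Real.volume_real_Ico_of_le hst]

theorem quality_real_Ici {θ : ℝ} (h : θ ∈ Icc (0 : ℝ) 1) : quality.real (Ici θ) = 1 - θ := by
  have : Ici θ ∩ Icc 0 1 = Icc θ 1 := by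
    ext s; simp only [mem_inter_iff, mem_Ici, mem_Icc]
    exact ⟨fun hs => ⟨hs.1, hs.2.2⟩, fun hs => ⟨hs.1, h.1.trans hs.1, hs.2⟩⟩
  rw [quality, measureReal_restrict_apply measurableSet_Ici, this, Real.volume_real_Icc_of_le h.2]

theorem quality_real_Iio {θ : ℝ} (h : θ ∈ Icc (0 : ℝ) 1) : quality.real (Iio θ) = θ := by
  rw [← compl_Ici, probReal_compl_eq_one_sub measurableSet_Ici, quality_real_Ici h]; ring

theorem qualities_real_prod (s t : Set ℝ) :
    qualities.real (s ×ˢ t) = quality.real s * quality.real t := by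
  rw [qualities, measureReal_prod_prod]

/-- If the event `A`, with the roles of the firms exchanged, is contained in `B`, and `B` contains
a further event of positive probability, then `B` is more likely than `A`. -/
theorem qualities_real_lt_of_swap {A B T : Set (ℝ × ℝ)} (hA : MeasurableSet A)
    (hT : MeasurableSet T) (hAB : Prod.swap ⁻¹' A ⊆ B) (hTB : T ⊆ B)
    (hd : Disjoint (Prod.swap ⁻¹' A) T) (hpos : 0 < qualities.real T) :
    qualities.real A < qualities.real B := by
  have h1 : qualities.real (Prod.swap ⁻¹' A) = qualities.real A := by
    have : MeasurePreserving (Prod.swap : ℝ × ℝ → ℝ × ℝ) qualities qualities :=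
      Measure.measurePreserving_swap
    exact this.measureReal_preimage hA.nullMeasurableSet
  have h2 : qualities.real (Prod.swap ⁻¹' A ∪ T) = _ := measureReal_union hd hT
  have h3 : qualities.real (Prod.swap ⁻¹' A ∪ T) ≤ qualities.real B :=
    measureReal_mono (union_subset hAB hTB)
  linarith

theorem measurable_outcome (θ : ℝ) : Measurable (outcome θ) :=
  measurable_to_bool (by
    have : outcome θ ⁻¹' {true} = Ici θ := by ext; simp [outcome]
    rw [this]; exact measurableSet_Ici)

theorem measurableSet_event_lt (x y : ℝ) (p q : Bool) :
    MeasurableSet {z : ℝ × ℝ | outcome x z.1 = p ∧ outcome y z.2 = q ∧ z.1 < z.2} :=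
  (((measurable_outcome x).comp measurable_fst) (measurableSet_singleton p)).inter
    ((((measurable_outcome y).comp measurable_snd) (measurableSet_singleton q)).inter
      (measurableSet_lt measurable_fst measurable_snd))

theorem measurableSet_event_gt (x y : ℝ) (p q : Bool) :
    MeasurableSet {z : ℝ × ℝ | outcome x z.1 = p ∧ outcome y z.2 = q ∧ z.2 < z.1} :=
  (((measurable_outcome x).comp measurable_fst) (measurableSet_singleton p)).inter
    ((((measurable_outcome y).comp measurable_snd) (measurableSet_singleton q)).inter
      (measurableSet_lt measurable_snd measurable_fst))

namespace IsRational

variable {r : SelectionRule} {x y : ℝ}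

theorem eq_one_of_lt (hr : IsRational r) (hx : x ∈ Icc (0 : ℝ) 1) (hy : y ∈ Icc (0 : ℝ) 1)
    {p q : Bool}
    (h : qualities.real {z | outcome x z.1 = p ∧ outcome y z.2 = q ∧ z.1 < z.2} <
      qualities.real {z | outcome x z.1 = p ∧ outcome y z.2 = q ∧ z.2 < z.1}) :
    r x y p q = 1 := by
  have h1 := hr.optimal x hx y hy p q 1 (by simp)
  have h2 := (hr.mem_Icc x y p q).2
  unfold errorProb at h1
  nlinarith

theorem eq_zero_of_lt (hr : IsRational r) (hx : x ∈ Icc (0 : ℝ) 1) (hy : y ∈ Icc (0 : ℝ) 1)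
    {p q : Bool}
    (h : qualities.real {z | outcome x z.1 = p ∧ outcome y z.2 = q ∧ z.2 < z.1} <
      qualities.real {z | outcome x z.1 = p ∧ outcome y z.2 = q ∧ z.1 < z.2}) :
    r x y p q = 0 := by
  have h1 := hr.optimal x hx y hy p q 0 (by simp)
  have h2 := (hr.mem_Icc x y p q).1
  unfold errorProb at h1
  nlinarith

/-- Exchanging the qualities turns every misranking in favour of `X` into a correct ranking. The
surplus event is that `Y` lies in `[y, x)`, below every passing `X`; it has positive probability
because `x < 1`. -/
theorem pass_pass (hr : IsRational r) (hy : 0 ≤ y) (hyx : y < x) (hx : x < 1) :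
    r x y true true = 1 := by
  have hx' : x ∈ Icc (0 : ℝ) 1 := ⟨by linarith, by linarith⟩
  refine hr.eq_one_of_lt hx' ⟨hy, by linarith⟩
    (qualities_real_lt_of_swap (T := Ici x ×ˢ Ico y x) (measurableSet_event_lt _ _ _ _)
      (measurableSet_Ici.prod measurableSet_Ico) ?_ ?_ ?_ ?_)
  · rintro ⟨s, t⟩ h
    simp [outcome] at h ⊢
    exact ⟨by linarith, by linarith, by linarith⟩
  · rintro ⟨s, t⟩ h
    simp [outcome] at h ⊢
    exact ⟨by linarith, by linarith, by linarith⟩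
  · rw [disjoint_left]
    rintro ⟨s, t⟩ h h'
    simp [outcome] at h h'
    linarith
  · rw [qualities_real_prod, quality_real_Ici hx', quality_real_Ico hy hyx.le hx.le]
    exact mul_pos (by linarith) (by linarith)

/-- Mirror image of `pass_pass`: the surplus event has `X` in `[y, x)`, above every failing `Y`, and
`0 < y` makes it likely. -/
theorem fail_fail (hr : IsRational r) (hy : 0 < y) (hyx : y < x) (hx : x ≤ 1) :
    r x y false false = 1 := by
  have hy' : y ∈ Icc (0 : ℝ) 1 := ⟨by linarith, by linarith⟩
  refine hr.eq_one_of_lt ⟨by linarith, hx⟩ hy'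
    (qualities_real_lt_of_swap (T := Ico y x ×ˢ Iio y) (measurableSet_event_lt _ _ _ _)
      (measurableSet_Ico.prod measurableSet_Iio) ?_ ?_ ?_ ?_)
  · rintro ⟨s, t⟩ h
    simp [outcome] at h ⊢
    exact ⟨by linarith, by linarith, by linarith⟩
  · rintro ⟨s, t⟩ h
    simp [outcome] at h ⊢
    exact ⟨by linarith, by linarith, by linarith⟩
  · rw [disjoint_left]
    rintro ⟨s, t⟩ h h'
    simp [outcome] at h h'
    linarith
  · rw [qualities_real_prod, quality_real_Iio hy', quality_real_Ico hy.le hyx.le hx]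
    exact mul_pos (by linarith) (by linarith)

theorem pass_fail (hr : IsRational r) (hy : 0 < y) (hyx : y ≤ x) (hx : x < 1) :
    r x y true false = 1 := by
  have hx' : x ∈ Icc (0 : ℝ) 1 := ⟨by linarith, by linarith⟩
  have hy' : y ∈ Icc (0 : ℝ) 1 := ⟨by linarith, by linarith⟩
  refine hr.eq_one_of_lt hx' hy'
    (qualities_real_lt_of_swap (T := Ici x ×ˢ Iio y) (measurableSet_event_lt _ _ _ _)
      (measurableSet_Ici.prod measurableSet_Iio) ?_ ?_ ?_ ?_)
  · rintro ⟨s, t⟩ h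
    simp [outcome] at h
    linarith
  · rintro ⟨s, t⟩ h
    simp [outcome] at h ⊢
    exact ⟨by linarith, by linarith, by linarith⟩
  · rw [disjoint_left]
    rintro ⟨s, t⟩ h h'
    simp [outcome] at h h'
    linarith
  · rw [qualities_real_prod, quality_real_Iio hy', quality_real_Ici hx']
    exact mul_pos (by linarith) (by linarith)

/-- A threshold `t` strictly inside `(0, 1)` is needed so that failing or passing is informative;
either of the two serves. None exists for the pair `1`, `0`. -/
theorem fail_pass (hr : IsRational r) (hy : y ∈ Icc (0 : ℝ) 1) (hyx : y ≤ x)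
    (hx : x ∈ Icc (0 : ℝ) 1) {t : ℝ} (ht : t = x ∨ t = y) (ht0 : 0 < t) (ht1 : t < 1) :
    r x y false true = 0 := by
  have ht' : t ∈ Icc (0 : ℝ) 1 := ⟨by linarith, by linarith⟩
  have hyt : y ≤ t := by rcases ht with rfl | rfl <;> linarith
  have htx : t ≤ x := by rcases ht with rfl | rfl <;> linarith
  refine hr.eq_zero_of_lt hx hy
    (qualities_real_lt_of_swap (T := Iio t ×ˢ Ici t) (measurableSet_event_gt _ _ _ _)
      (measurableSet_Iio.prod measurableSet_Ici) ?_ ?_ ?_ ?_)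
  · rintro ⟨s, t⟩ h
    simp [outcome] at h ⊢
    exact ⟨by linarith, by linarith, by linarith⟩
  · rintro ⟨s, t⟩ h
    simp [outcome] at h ⊢
    exact ⟨by linarith, by linarith, by linarith⟩
  · rw [disjoint_left]
    rintro ⟨s, t'⟩ h h'
    simp [outcome] at h h'
    rcases ht with rfl | rfl <;> linarith
  · rw [qualities_real_prod, quality_real_Iio ht', quality_real_Ici ht']
    exact mul_pos (by linarith) (by linarith)

end IsRational

/-! ### The reduced game between the firms -/

theorem winProb_eq (r : SelectionRule) {x y : ℝ} (hx : x ∈ Icc (0 : ℝ) 1)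
    (hy : y ∈ Icc (0 : ℝ) 1) :
    winProb r x y = r x y true true * ((1 - x) * (1 - y)) + r x y true false * ((1 - x) * y) +
      r x y false true * (x * (1 - y)) + r x y false false * (x * y) := by
  have hm : ∀ (c : ℝ) {S T : Set ℝ}, MeasurableSet S → MeasurableSet T →
      Integrable (fun z => (S ×ˢ T).indicator (fun _ => c) z) qualities := fun c S T hS hT =>
    (integrable_const c).indicator (hS.prod hT)
  have hi : ∀ (c : ℝ) {S T : Set ℝ}, MeasurableSet S → MeasurableSet T →
      ∫ z, (S ×ˢ T).indicator (fun _ => c) z ∂qualities = c * (quality.real S * quality.real T) :=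
    fun c S T hS hT => by
      rw [integral_indicator_const c (hS.prod hT), qualities_real_prod, smul_eq_mul, mul_comm]
  have e : (fun z : ℝ × ℝ => r x y (outcome x z.1) (outcome y z.2)) = fun z =>
      (Ici x ×ˢ Ici y).indicator (fun _ => r x y true true) z +
      (Ici x ×ˢ Iio y).indicator (fun _ => r x y true false) z +
      (Iio x ×ˢ Ici y).indicator (fun _ => r x y false true) z +
      (Iio x ×ˢ Iio y).indicator (fun _ => r x y false false) z := by
    ext ⟨s, t⟩
    by_cases h1 : x ≤ s <;> by_cases h2 : y ≤ t <;>
      simp [outcome, indicator, h1, h2, not_lt.2, not_le.1]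
  rw [winProb, e, integral_add, integral_add, integral_add, hi _ measurableSet_Ici measurableSet_Ici,
    hi _ measurableSet_Ici measurableSet_Iio, hi _ measurableSet_Iio measurableSet_Ici,
    hi _ measurableSet_Iio measurableSet_Iio, quality_real_Ici hx, quality_real_Ici hy,
    quality_real_Iio hx, quality_real_Iio hy]
  · exact hm _ measurableSet_Ici measurableSet_Ici
  · exact hm _ measurableSet_Ici measurableSet_Iio
  · exact (hm _ measurableSet_Ici measurableSet_Ici).add (hm _ measurableSet_Ici measurableSet_Iio)
  · exact hm _ measurableSet_Iio measurableSet_Ici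
  · exact ((hm _ measurableSet_Ici measurableSet_Ici).add
      (hm _ measurableSet_Ici measurableSet_Iio)).add (hm _ measurableSet_Iio measurableSet_Ici)
  · exact hm _ measurableSet_Iio measurableSet_Iio

/-- Probability that the firm with threshold `x` is selected against threshold `y`, under a
rational principal. -/
noncomputable def payoff (x y : ℝ) : ℝ :=
  if y < x then 1 - x * (1 - y) else if x < y then y * (1 - x) else 1 / 2

theorem payoff_add_payoff (x y : ℝ) : payoff x y + payoff y x = 1 := by
  unfold payoff
  rcases lt_trichotomy x y with h | rfl | h
  · simp [h, h.not_gt]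
  · norm_num
  · simp [h, h.not_gt]

/-- Each choice left open by rationality belongs to an outcome of probability zero, so it drops out
of `winProb_eq`. The exception is `x = 1`, `y = 0`, where fail/pass is almost sure and the principal
is indifferent. -/
theorem IsRational.winProb_of_le {r : SelectionRule} (hr : IsRational r) {x y : ℝ}
    (hx : x ∈ Icc (0 : ℝ) 1) (hy : y ∈ Icc (0 : ℝ) 1) (h : y ≤ x) (hne : ¬(x = 1 ∧ y = 0)) :
    winProb r x y = payoff x y := by
  rw [winProb_eq r hx hy]
  have hFT : r x y false true * (x * (1 - y)) = 0 := by
    rcases hx.1.eq_or_lt with h0 | h0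
    · simp [← h0]
    rcases hy.2.eq_or_lt with h1 | h1
    · simp [h1]
    rcases hx.2.eq_or_lt with h2 | h2
    · rcases hy.1.eq_or_lt with h3 | h3
      · exact absurd ⟨h2, h3.symm⟩ hne
      · rw [hr.fail_pass hy h hx (Or.inr rfl) h3 h1, zero_mul]
    · rw [hr.fail_pass hy h hx (Or.inl rfl) h0 h2, zero_mul]
  have hTF : r x y true false * ((1 - x) * y) = (1 - x) * y := by
    rcases hx.2.eq_or_lt with h2 | h2
    · simp [h2]
    rcases hy.1.eq_or_lt with h3 | h3
    · simp [← h3]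
    rw [hr.pass_fail h3 h h2, one_mul]
  rw [hFT, hTF]
  rcases h.eq_or_lt with rfl | h
  · simp only [hr.tie, payoff, lt_irrefl, if_false]
    ring
  · have hTT : r x y true true * ((1 - x) * (1 - y)) = (1 - x) * (1 - y) := by
      rcases hx.2.eq_or_lt with h2 | h2
      · simp [h2]
      rw [hr.pass_pass hy.1 h h2, one_mul]
    have hFF : r x y false false * (x * y) = x * y := by
      rcases hy.1.eq_or_lt with h3 | h3
      · simp [← h3]
      rw [hr.fail_fail h3 h hx.2, one_mul]
    rw [hTT, hFF, payoff, if_pos h]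
    ring

/-- Exchanging the roles of the two firms. -/
theorem IsRational.swap {r : SelectionRule} (hr : IsRational r) :
    IsRational fun x y p q => 1 - r y x q p where
  mem_Icc x y p q := by
    have := hr.mem_Icc y x q p
    exact ⟨by linarith [this.2], by linarith [this.1]⟩
  optimal x hx y hy p q c hc := by
    have h := hr.optimal y hy x hx q p (1 - c) ⟨by linarith [hc.2], by linarith [hc.1]⟩
    have hs : MeasurePreserving (Prod.swap : ℝ × ℝ → ℝ × ℝ) qualities qualities :=
      Measure.measurePreserving_swap
    have h1 := hs.measureReal_preimage (measurableSet_event_lt y x q p).nullMeasurableSet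
    have h2 := hs.measureReal_preimage (measurableSet_event_gt y x q p).nullMeasurableSet
    have e1 : Prod.swap ⁻¹' {z : ℝ × ℝ | outcome y z.1 = q ∧ outcome x z.2 = p ∧ z.1 < z.2} =
        {z : ℝ × ℝ | outcome x z.1 = p ∧ outcome y z.2 = q ∧ z.2 < z.1} := by
      ext z; simp; tauto
    have e2 : Prod.swap ⁻¹' {z : ℝ × ℝ | outcome y z.1 = q ∧ outcome x z.2 = p ∧ z.2 < z.1} =
        {z : ℝ × ℝ | outcome x z.1 = p ∧ outcome y z.2 = q ∧ z.1 < z.2} := by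
      ext z; simp; tauto
    rw [e1] at h1
    rw [e2] at h2
    unfold errorProb at h ⊢
    rw [h1, h2]
    linarith
  tie x p := by rw [hr.tie]; norm_num

theorem IsRational.winProb_eq_payoff {r : SelectionRule} (hr : IsRational r) {x y : ℝ}
    (hx : x ∈ Icc (0 : ℝ) 1) (hy : y ∈ Icc (0 : ℝ) 1) (h1 : ¬(x = 1 ∧ y = 0))
    (h2 : ¬(x = 0 ∧ y = 1)) : winProb r x y = payoff x y := by
  rcases le_total y x with h | h
  · exact hr.winProb_of_le hx hy h h1
  · have h3 := hr.swap.winProb_of_le hy hx h (fun h => h2 ⟨h.2, h.1⟩)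
    have h4 := payoff_add_payoff x y
    rw [winProb_eq _ hy hx] at h3
    rw [winProb_eq _ hx hy]
    linarith

/-! ### Winning probability against a mixed strategy -/

open ProbabilityTheory Filter Topology

theorem measurable_payoff : Measurable fun w : ℝ × ℝ => payoff w.1 w.2 := by
  unfold payoff
  refine Measurable.ite (measurableSet_lt measurable_snd measurable_fst) (by fun_prop)
    (Measurable.ite (measurableSet_lt measurable_fst measurable_snd) (by fun_prop) (by fun_prop))

theorem payoff_mem_Icc {x y : ℝ} (hx : x ∈ Icc (0 : ℝ) 1) (hy : y ∈ Icc (0 : ℝ) 1) :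
    payoff x y ∈ Icc (0 : ℝ) 1 := by
  obtain ⟨hx0, hx1⟩ := hx
  obtain ⟨hy0, hy1⟩ := hy
  unfold payoff
  split_ifs <;> constructor <;> nlinarith

/-- Winning probability of the threshold `x` against a threshold drawn from `ν`. -/
noncomputable def meanPayoff (ν : Measure ℝ) (x : ℝ) : ℝ := ∫ y, payoff x y ∂ν

/-- The common factor `(1 - x)² + x²`. -/
def sqSum (x : ℝ) : ℝ := (1 - x) ^ 2 + x ^ 2

theorem sqSum_pos (x : ℝ) : 0 < sqSum x := by
  unfold sqSum; nlinarith [sq_nonneg (2 * x - 1)]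

/-- As a function of `y` the payoff is piecewise affine: at `y = x` it drops by `sqSum x`, a tie
being the midpoint, and its slope changes from `x` to `1 - x`. Integrated termwise, this yields the
mean, the cdf, the atom at `x` and the integrated cdf. -/
theorem payoff_eq (x y : ℝ) :
    payoff x y = (1 - x) * y + sqSum x * (Iic x).indicator 1 y -
      sqSum x / 2 * ({x} : Set ℝ).indicator 1 y - (2 * x - 1) * max (x - y) 0 := by
  unfold payoff sqSum
  rcases lt_trichotomy y x with h | rfl | h
  · rw [if_pos h, max_eq_left (by linarith)]
    simp [indicator, h.le, h.ne]
    ring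
  · simp
    ring
  · rw [if_neg h.not_gt, if_pos h, max_eq_right (by linarith)]
    simp [indicator, h.ne', h.not_ge]
    ring

theorem intervalIntegrable_cdf (ν : Measure ℝ) (s t : ℝ) :
    IntervalIntegrable (cdf ν) volume s t :=
  (monotone_cdf ν).intervalIntegrable

section

variable {a b : ℝ} {ν : Measure ℝ} [IsProbabilityMeasure ν]

/-- Fubini for the indicator of `y ≤ t`. -/
theorem integral_cdf (hν : ∀ᵐ y ∂ν, a ≤ y) {x : ℝ} (hx : a ≤ x) :
    ∫ t in a..x, cdf ν t = ∫ y, max (x - y) 0 ∂ν := by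
  have hm : MeasurableSet {p : ℝ × ℝ | p.2 ≤ p.1} := measurableSet_le measurable_snd measurable_fst
  have h1 : ∀ t, cdf ν t = ∫ y, {p : ℝ × ℝ | p.2 ≤ p.1}.indicator (fun _ => (1 : ℝ)) (t, y) ∂ν := by
    intro t
    have : (fun y => {p : ℝ × ℝ | p.2 ≤ p.1}.indicator (fun _ => (1 : ℝ)) (t, y)) =
        (Iic t).indicator (fun _ => (1 : ℝ)) := by ext y; simp [indicator]
    rw [this, integral_indicator_const _ measurableSet_Iic, cdf_eq_real]; simp
  rw [intervalIntegral.integral_of_le hx, ← integral_Icc_eq_integral_Ioc]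
  simp_rw [h1]
  rw [integral_integral_swap]
  · refine integral_congr_ae (hν.mono fun y hy => ?_)
    have : (fun t => {p : ℝ × ℝ | p.2 ≤ p.1}.indicator (fun _ => (1 : ℝ)) (t, y)) =
        (Ici y).indicator (fun _ => (1 : ℝ)) := by ext t; simp [indicator]
    have h2 : Ici y ∩ Icc a x = Icc y x := by
      ext t; simp only [mem_inter_iff, mem_Ici, mem_Icc]
      exact ⟨fun h => ⟨h.1, h.2.2⟩, fun h => ⟨h.1, hy.trans h.1, h.2⟩⟩
    simp only [this]
    rw [integral_indicator_const _ measurableSet_Ici, measureReal_restrict_apply measurableSet_Ici,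
      h2, Real.volume_real_Icc]
    simp
  · exact (integrable_const (1 : ℝ)).indicator hm

theorem integrable_id_of_mem_Icc (hν : ∀ᵐ y ∂ν, y ∈ Icc a b) : Integrable (fun y : ℝ => y) ν :=
  Integrable.of_mem_Icc a b measurable_id.aemeasurable hν

theorem integrable_max_sub (hν : ∀ᵐ y ∂ν, y ∈ Icc a b) (x : ℝ) :
    Integrable (fun y : ℝ => max (x - y) 0) ν :=
  Integrable.of_mem_Icc 0 (max (x - a) 0) (by fun_prop) (hν.mono fun y hy =>
    ⟨le_max_right _ _, max_le_max (by linarith [hy.1]) le_rfl⟩)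

theorem integral_id_eq (hab : a ≤ b) (hν : ∀ᵐ y ∂ν, y ∈ Icc a b) :
    ∫ y, y ∂ν = b - ∫ t in a..b, cdf ν t := by
  have h : ∫ y, max (b - y) 0 ∂ν = ∫ y, (b - y) ∂ν :=
    integral_congr_ae (hν.mono fun y hy => max_eq_left (by linarith [hy.2]))
  rw [integral_cdf (hν.mono fun y hy => hy.1) hab, h,
    integral_sub (integrable_const b) (integrable_id_of_mem_Icc hν)]
  simp

/-- Right limit of `meanPayoff ν` at `x`. -/
noncomputable def limitPayoff (a b : ℝ) (ν : Measure ℝ) (x : ℝ) : ℝ :=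
  (1 - x) * (b - ∫ t in a..b, cdf ν t) + sqSum x * cdf ν x - (2 * x - 1) * ∫ t in a..x, cdf ν t

theorem meanPayoff_eq (hab : a ≤ b) (hν : ∀ᵐ y ∂ν, y ∈ Icc a b) {x : ℝ} (hx : a ≤ x) :
    meanPayoff ν x = limitPayoff a b ν x - sqSum x / 2 * ν.real {x} := by
  have i1 := (integrable_id_of_mem_Icc hν).const_mul (1 - x)
  have i2 : Integrable (fun y => sqSum x * (Iic x).indicator (1 : ℝ → ℝ) y) ν :=
    ((integrable_const (1 : ℝ)).indicator measurableSet_Iic).const_mul _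
  have i3 : Integrable (fun y => sqSum x / 2 * ({x} : Set ℝ).indicator (1 : ℝ → ℝ) y) ν :=
    ((integrable_const (1 : ℝ)).indicator (measurableSet_singleton x)).const_mul _
  have i4 := (integrable_max_sub hν x).const_mul (2 * x - 1)
  unfold meanPayoff limitPayoff
  simp_rw [payoff_eq]
  refine (integral_sub ((i1.add i2).sub i3) i4).trans ?_
  rw [integral_sub' (i1.add i2) i3, integral_add' i1 i2, integral_const_mul, integral_const_mul,
    integral_const_mul, integral_const_mul, integral_indicator_one measurableSet_Iic,
    integral_indicator_one (measurableSet_singleton x),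
    integral_id_eq hab hν, ← integral_cdf (hν.mono fun y hy => hy.1) hx, cdf_eq_real]
  ring

theorem measureReal_singleton_le {x t : ℝ} (h : x < t) : ν.real {t} ≤ cdf ν t - cdf ν x := by
  have h1 : ν.real (Iic x ∪ {t}) = ν.real (Iic x) + ν.real {t} :=
    measureReal_union (by simpa using h) (measurableSet_singleton t)
  have h2 : ν.real (Iic x ∪ {t}) ≤ ν.real (Iic t) :=
    measureReal_mono (union_subset (Iic_subset_Iic.2 h.le) (by simp))
  rw [cdf_eq_real, cdf_eq_real]
  linarith

theorem continuous_integral_cdf (ν : Measure ℝ) (a : ℝ) :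
    Continuous fun x => ∫ t in a..x, cdf ν t :=
  intervalIntegral.continuous_primitive (intervalIntegrable_cdf ν) a

/-- The tie correction vanishes in the limit, since an atom at `t > x` is at most `cdf ν t - cdf ν
x`, which tends to `0` by right continuity. Thus a threshold slightly above `x` collects the whole
gain from an atom at `x`. -/
theorem tendsto_meanPayoff (hν : ∀ᵐ y ∂ν, y ∈ Icc a b) {x : ℝ} (hx : x ∈ Ico a b) :
    Tendsto (meanPayoff ν) (𝓝[>] x) (𝓝 (limitPayoff a b ν x)) := by
  have hG : Tendsto (cdf ν) (𝓝[>] x) (𝓝 (cdf ν x)) :=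
    ((cdf ν).right_continuous x).mono_left (nhdsWithin_mono x Ioi_subset_Ici_self)
  have hatom : Tendsto (fun t => ν.real {t}) (𝓝[>] x) (𝓝 0) := by
    refine squeeze_zero' (Eventually.of_forall fun t => measureReal_nonneg)
      (eventually_mem_nhdsWithin.mono fun t ht => measureReal_singleton_le ht) ?_
    simpa using hG.sub_const (cdf ν x)
  have hcont : ∀ f : ℝ → ℝ, Continuous f → Tendsto f (𝓝[>] x) (𝓝 (f x)) :=
    fun f hf => hf.continuousAt.mono_left nhdsWithin_le_nhds
  have hg : Continuous sqSum := by unfold sqSum; fun_prop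
  have key : Tendsto (fun t => limitPayoff a b ν t - sqSum t / 2 * ν.real {t}) (𝓝[>] x)
      (𝓝 (limitPayoff a b ν x - sqSum x / 2 * 0)) := by
    refine Tendsto.sub ?_ ((hcont (fun t => sqSum t / 2) (by fun_prop)).mul hatom)
    exact ((hcont (fun t => (1 - t) * (b - ∫ t in a..b, cdf ν t)) (by fun_prop)).add
      ((hcont _ hg).mul hG)).sub ((hcont (fun t => 2 * t - 1) (by fun_prop)).mul
        (hcont _ (continuous_integral_cdf ν a)))
  rw [mul_zero, sub_zero] at key
  refine key.congr' (eventually_mem_nhdsWithin.mono fun t ht => ?_)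
  exact (meanPayoff_eq (hx.1.trans hx.2.le) hν (hx.1.trans (le_of_lt ht))).symm

theorem limitPayoff_le (hν : ∀ᵐ y ∂ν, y ∈ Icc a b) {c : ℝ}
    (h : ∀ t ∈ Ioo a b, meanPayoff ν t ≤ c) {x : ℝ} (hx : x ∈ Ico a b) :
    limitPayoff a b ν x ≤ c := by
  refine le_of_tendsto (tendsto_meanPayoff hν hx) ?_
  filter_upwards [Ioo_mem_nhdsGT hx.2] with t ht
  exact h t ⟨hx.1.trans_lt ht.1, ht.2⟩

theorem limitPayoff_eq (hν : ∀ᵐ y ∂ν, y ∈ Icc a b) {c x : ℝ} (hx : x ∈ Ico a b)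
    (h : ∃ᶠ t in 𝓝[>] x, meanPayoff ν t = c) : limitPayoff a b ν x = c :=
  isClosed_singleton.mem_of_frequently_of_tendsto h (tendsto_meanPayoff hν hx)

end

/-! ### Equilibria of the constant-sum game -/

theorem ae_mem_of_mem_strategies {S : Set ℝ} {μ : ProbabilityMeasure ℝ} (h : μ ∈ strategies S) :
    ∀ᵐ x ∂(μ : Measure ℝ), x ∈ S :=
  mem_ae_iff.2 h

section

variable {μ ν : Measure ℝ} [IsProbabilityMeasure μ] [IsProbabilityMeasure ν]

theorem integrable_payoff (hμ : ∀ᵐ x ∂μ, x ∈ Icc (0 : ℝ) 1) (hν : ∀ᵐ x ∂ν, x ∈ Icc (0 : ℝ) 1) :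
    Integrable (fun w : ℝ × ℝ => payoff w.1 w.2) (μ.prod ν) := by
  refine Integrable.of_mem_Icc 0 1 measurable_payoff.aemeasurable ?_
  filter_upwards [Measure.quasiMeasurePreserving_fst.ae hμ,
    Measure.quasiMeasurePreserving_snd.ae hν] with w h1 h2
  exact payoff_mem_Icc h1 h2

theorem integrable_meanPayoff (hμ : ∀ᵐ x ∂μ, x ∈ Icc (0 : ℝ) 1)
    (hν : ∀ᵐ x ∂ν, x ∈ Icc (0 : ℝ) 1) : Integrable (meanPayoff ν) μ :=
  (integrable_payoff hμ hν).integral_prod_left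

theorem integral_meanPayoff_add (hμ : ∀ᵐ x ∂μ, x ∈ Icc (0 : ℝ) 1)
    (hν : ∀ᵐ x ∂ν, x ∈ Icc (0 : ℝ) 1) :
    ∫ x, meanPayoff ν x ∂μ + ∫ y, meanPayoff μ y ∂ν = 1 := by
  have hi := integrable_payoff hμ hν
  have hi' := integrable_payoff hν hμ
  have h1 : ∫ x, meanPayoff ν x ∂μ = ∫ w, payoff w.1 w.2 ∂(μ.prod ν) := (integral_prod _ hi).symm
  have h2 : ∫ y, meanPayoff μ y ∂ν = ∫ w, payoff w.2 w.1 ∂(μ.prod ν) := by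
    have := integral_prod_swap (μ := ν) (ν := μ) (fun w : ℝ × ℝ => payoff w.1 w.2)
    exact (integral_prod _ hi').symm.trans this.symm
  have h3 := integral_add hi hi'.swap
  simp only [Function.comp_apply, Prod.fst_swap, Prod.snd_swap] at h3
  rw [h1, h2, ← h3]
  simp [payoff_add_payoff]

end

/-- Thresholds drawn from `ν` in `[a,b]` almost surely avoid the pair `0`, `1`, for which both
outcomes are deterministic and different. -/
def AvoidsTrivial (a b : ℝ) (ν : Measure ℝ) : Prop :=
  0 < a ∨ b < 1 ∨ ∀ᵐ x ∂ν, x ≠ 0 ∧ x ≠ 1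

section

variable {r : SelectionRule} {a b : ℝ} {μX μY : ProbabilityMeasure ℝ}

/-- It suffices that one of the two strategies avoids `0` and `1`, because the exceptional pairs
involve both values. This permits arbitrary deviations against a well-behaved strategy. -/
theorem selectX_eq (hr : IsRational r) (ha : 0 ≤ a) (hb : b ≤ 1) (hX : μX ∈ strategies (Icc a b))
    (hY : μY ∈ strategies (Icc a b))
    (h : AvoidsTrivial a b (μX : Measure ℝ) ∨ AvoidsTrivial a b (μY : Measure ℝ)) :
    selectX r μX μY = ∫ x, meanPayoff μY x ∂(μX : Measure ℝ) := by
  have hX' := ae_mem_of_mem_strategies hX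
  have hY' := ae_mem_of_mem_strategies hY
  have hi := integrable_payoff (hX'.mono fun x hx => Icc_subset_Icc ha hb hx)
    (hY'.mono fun x hx => Icc_subset_Icc ha hb hx)
  have e : ∀ᵐ w ∂((μX : Measure ℝ).prod (μY : Measure ℝ)),
      winProb r w.1 w.2 = payoff w.1 w.2 := by
    have hne : ∀ᵐ w ∂((μX : Measure ℝ).prod (μY : Measure ℝ)), w.1 ∈ Icc a b → w.2 ∈ Icc a b →
        ¬(w.1 = 1 ∧ w.2 = 0) ∧ ¬(w.1 = 0 ∧ w.2 = 1) := by
      by_cases h0 : 0 < a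
      · refine Eventually.of_forall fun w h1 h2 => ⟨fun h => ?_, fun h => ?_⟩
        · linarith [h2.1, h.2]
        · linarith [h1.1, h.1]
      by_cases hb1 : b < 1
      · refine Eventually.of_forall fun w h1 h2 => ⟨fun h => ?_, fun h => ?_⟩
        · linarith [h1.2, h.1]
        · linarith [h2.2, h.2]
      simp only [AvoidsTrivial, h0, hb1, false_or] at h
      rcases h with h | h
      · filter_upwards [Measure.quasiMeasurePreserving_fst.ae h] with w hw _ _
        exact ⟨fun h => hw.2 h.1, fun h => hw.1 h.1⟩
      · filter_upwards [Measure.quasiMeasurePreserving_snd.ae h] with w hw _ _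
        exact ⟨fun h => hw.1 h.2, fun h => hw.2 h.2⟩
    filter_upwards [Measure.quasiMeasurePreserving_fst.ae hX',
      Measure.quasiMeasurePreserving_snd.ae hY', hne] with w h1 h2 h3
    exact hr.winProb_eq_payoff (Icc_subset_Icc ha hb h1) (Icc_subset_Icc ha hb h2) (h3 h1 h2).1
      (h3 h1 h2).2
  rw [selectX, integral_congr_ae e, integral_prod _ hi]
  rfl

theorem selectY_eq (hr : IsRational r) (ha : 0 ≤ a) (hb : b ≤ 1) (hX : μX ∈ strategies (Icc a b))
    (hY : μY ∈ strategies (Icc a b))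
    (h : AvoidsTrivial a b (μX : Measure ℝ) ∨ AvoidsTrivial a b (μY : Measure ℝ)) :
    selectY r μX μY = ∫ y, meanPayoff μX y ∂(μY : Measure ℝ) := by
  have hX' := ae_mem_of_mem_strategies hX
  have hY' := ae_mem_of_mem_strategies hY
  have := integral_meanPayoff_add (hX'.mono fun x hx => Icc_subset_Icc ha hb hx)
    (hY'.mono fun x hx => Icc_subset_Icc ha hb hx)
  rw [selectY, selectX_eq hr ha hb hX hY h]
  linarith

variable {μ ν : ProbabilityMeasure ℝ}

theorem integral_meanPayoff_le (ha : 0 ≤ a) (hb : b ≤ 1) (hμ : μ ∈ strategies (Icc a b))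
    (hU : ∀ x ∈ Icc a b, meanPayoff μ x ≤ 1 / 2) (hν : ν ∈ strategies (Icc a b)) :
    ∫ x, meanPayoff μ x ∂(ν : Measure ℝ) ≤ 1 / 2 := by
  have hμ' := (ae_mem_of_mem_strategies hμ).mono fun x hx => Icc_subset_Icc ha hb hx
  have hν' := ae_mem_of_mem_strategies hν
  calc _ ≤ ∫ _, (1 / 2 : ℝ) ∂(ν : Measure ℝ) :=
        integral_mono_ae (integrable_meanPayoff (hν'.mono fun x hx => Icc_subset_Icc ha hb hx) hμ')
          (integrable_const _) (hν'.mono fun x hx => hU x hx)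
    _ = 1 / 2 := by simp

theorem isEquilibrium_self (hr : IsRational r) (ha : 0 ≤ a) (hb : b ≤ 1)
    (hμ : μ ∈ strategies (Icc a b)) (hU : ∀ x ∈ Icc a b, meanPayoff μ x ≤ 1 / 2)
    (hc : AvoidsTrivial a b (μ : Measure ℝ)) : IsEquilibrium r (Icc a b) μ μ := by
  have hX := selectX_eq hr ha hb hμ hμ (Or.inl hc)
  have hY := selectY_eq hr ha hb hμ hμ (Or.inl hc)
  have hs : selectY r μ μ = 1 - selectX r μ μ := rfl
  -- By `hX`, `hY` and `hs` both firms earn the same integral and the two sum to 1, so each earns `1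
  -- / 2`.
  refine ⟨hμ, hμ, fun ν hν => ?_, fun ν hν => ?_⟩
  · rw [selectX_eq hr ha hb hν hμ (Or.inr hc)]
    linarith [integral_meanPayoff_le ha hb hμ hU hν]
  · rw [selectY_eq hr ha hb hμ hν (Or.inl hc)]
    linarith [integral_meanPayoff_le ha hb hμ hU hν]

/-- The pure strategy `x`. -/
noncomputable def pure (x : ℝ) : ProbabilityMeasure ℝ := ⟨Measure.dirac x, inferInstance⟩

theorem pure_mem_strategies {S : Set ℝ} (hS : MeasurableSet S) {x : ℝ} (hx : x ∈ S) :
    pure x ∈ strategies S := by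
  change Measure.dirac x Sᶜ = 0
  rw [Measure.dirac_apply' _ hS.compl]
  simp [hx]

theorem avoidsTrivial_pure {x : ℝ} (ha : 0 ≤ a) (hb : b ≤ 1)
    (hx : 0 < a ∨ b < 1 ∨ x ∈ Ioo a b) : AvoidsTrivial a b (pure x : Measure ℝ) := by
  refine hx.imp_right (Or.imp_right fun hx => ?_)
  change ∀ᵐ y ∂(Measure.dirac x), y ≠ 0 ∧ y ≠ 1
  rw [ae_dirac_eq]
  exact ⟨by linarith [hx.1], by linarith [hx.2]⟩

theorem integral_pure (f : ℝ → ℝ) (x : ℝ) : ∫ y, f y ∂(pure x : Measure ℝ) = f x :=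
  integral_dirac f x

/-- Properties shared by both components of any equilibrium, when `μ` is an optimal strategy. -/
structure IsOptimalAgainst (a b : ℝ) (μ ν : Measure ℝ) : Prop where
  mem_Icc : ∀ᵐ x ∂ν, x ∈ Icc a b
  meanPayoff_le : ∀ x ∈ Icc a b, (0 < a ∨ b < 1 ∨ x ∈ Ioo a b) → meanPayoff ν x ≤ 1 / 2
  integral_left : ∫ x, meanPayoff μ x ∂ν = 1 / 2
  integral_right : ∫ x, meanPayoff ν x ∂μ = 1 / 2

/-- Interchangeability in constant-sum games: deviating to `μ` secures each firm at least `1 / 2`,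
so both get exactly `1 / 2` and all the inequalities are equalities. Pure deviations give the
pointwise bound, except at the endpoints when `a = 0` and `b = 1`, where they may meet the
uninformative pair. -/
theorem IsEquilibrium.isOptimalAgainst (hr : IsRational r) (ha : 0 ≤ a) (hb : b ≤ 1)
    (hμ : μ ∈ strategies (Icc a b)) (hU : ∀ x ∈ Icc a b, meanPayoff μ x ≤ 1 / 2)
    (hc : AvoidsTrivial a b (μ : Measure ℝ)) (h : IsEquilibrium r (Icc a b) μX μY) :
    IsOptimalAgainst a b (μ : Measure ℝ) (μX : Measure ℝ) ∧
      IsOptimalAgainst a b (μ : Measure ℝ) (μY : Measure ℝ) := by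
  have hs : ∀ κ τ, selectY r κ τ = 1 - selectX r κ τ := fun _ _ => rfl
  have mem : ∀ {κ : ProbabilityMeasure ℝ}, κ ∈ strategies (Icc a b) →
      ∀ᵐ x ∂(κ : Measure ℝ), x ∈ Icc (0 : ℝ) 1 := fun hκ =>
    (ae_mem_of_mem_strategies hκ).mono fun x hx => Icc_subset_Icc ha hb hx
  have hX := integral_meanPayoff_le ha hb hμ hU h.memX
  have hY := integral_meanPayoff_le ha hb hμ hU h.memY
  have eX := selectX_eq hr ha hb h.memX hμ (Or.inr hc)
  have eY := selectY_eq hr ha hb hμ h.memY (Or.inl hc)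
  have bX := h.bestX μ hμ
  have bY := h.bestY μ hμ
  have sX := integral_meanPayoff_add (mem h.memX) (mem hμ)
  have sY := integral_meanPayoff_add (mem h.memY) (mem hμ)
  rw [hs] at eY
  rw [hs, hs] at bY
  refine ⟨⟨ae_mem_of_mem_strategies h.memX, fun x hx hx' => ?_, by linarith, by linarith⟩,
    ⟨ae_mem_of_mem_strategies h.memY, fun x hx hx' => ?_, by linarith, by linarith⟩⟩
  · have hp := pure_mem_strategies measurableSet_Icc hx
    have b1 := h.bestY _ hp
    rw [selectY_eq hr ha hb h.memX hp (Or.inr (avoidsTrivial_pure ha hb hx')), integral_pure,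
      hs] at b1
    linarith
  · have hp := pure_mem_strategies measurableSet_Icc hx
    have b1 := h.bestX _ hp
    rw [selectX_eq hr ha hb hp h.memY (Or.inl (avoidsTrivial_pure ha hb hx')), integral_pure] at b1
    linarith

theorem isEquilibrium_iff (hr : IsRational r) (ha : 0 ≤ a) (hb : b ≤ 1)
    (hμ : μ ∈ strategies (Icc a b)) (hU : ∀ x ∈ Icc a b, meanPayoff μ x ≤ 1 / 2)
    (hc : AvoidsTrivial a b (μ : Measure ℝ))
    (huniq : ∀ ν : ProbabilityMeasure ℝ, IsOptimalAgainst a b (μ : Measure ℝ) (ν : Measure ℝ) →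
      ν = μ) : IsEquilibrium r (Icc a b) μX μY ↔ μX = μ ∧ μY = μ := by
  constructor
  · intro h
    have := h.isOptimalAgainst hr ha hb hμ hU hc
    exact ⟨huniq _ this.1, huniq _ this.2⟩
  · rintro ⟨rfl, rfl⟩
    exact isEquilibrium_self hr ha hb hμ hU hc

end

/-- Complementary slackness: an optimal strategy only uses best replies. -/
theorem ae_meanPayoff_eq {μ ν : Measure ℝ} [IsProbabilityMeasure μ]
    [IsProbabilityMeasure ν] (hμ : ∀ᵐ x ∂μ, x ∈ Icc (0 : ℝ) 1)
    (hν : ∀ᵐ x ∂ν, x ∈ Icc (0 : ℝ) 1) (hU : ∀ᵐ x ∂ν, meanPayoff μ x ≤ 1 / 2)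
    (h : ∫ x, meanPayoff μ x ∂ν = 1 / 2) : ∀ᵐ x ∂ν, meanPayoff μ x = 1 / 2 := by
  have hi := integrable_meanPayoff hν hμ
  have h0 : ∫ x, (1 / 2 - meanPayoff μ x) ∂ν = 0 := by
    rw [integral_sub (integrable_const _) hi, h]; simp
  have h1 := (integral_eq_zero_iff_of_nonneg_ae (f := fun x => 1 / 2 - meanPayoff μ x)
    (hU.mono fun x hx => sub_nonneg.2 hx) ((integrable_const _).sub hi)).1 h0
  exact h1.mono fun x hx => (sub_eq_zero.1 hx).symm

theorem eq_dirac_of_ae_eq {ν : Measure ℝ} [IsProbabilityMeasure ν] {b : ℝ}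
    (h : ∀ᵐ x ∂ν, x = b) : ν = Measure.dirac b := by
  have h1 : ν.map id = ν.map fun _ => b := Measure.map_congr h
  rwa [Measure.map_id, Measure.map_const, measure_univ, one_smul] at h1

/-! ### The case of a point mass at `b` -/

section

variable {a b : ℝ}

theorem meanPayoff_dirac (b x : ℝ) : meanPayoff (Measure.dirac b) x = payoff x b :=
  integral_dirac _ b

theorem payoff_right_endpoint {x : ℝ} (hx : x < b) : payoff x b = b * (1 - x) := by
  rw [payoff, if_neg hx.not_gt, if_pos hx]

theorem payoff_right_endpoint_lt (ha : 0 ≤ a) (h : (1 - a) * b ≤ 1 / 2) {x : ℝ}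
    (hx : x ∈ Ioo a b) : payoff x b < 1 / 2 := by
  rw [payoff_right_endpoint hx.2]
  nlinarith [hx.1, hx.2]

theorem meanPayoff_dirac_le (ha : 0 ≤ a) (h : (1 - a) * b ≤ 1 / 2) {x : ℝ}
    (hx : x ∈ Icc a b) : meanPayoff (Measure.dirac b) x ≤ 1 / 2 := by
  rw [meanPayoff_dirac]
  rcases hx.2.eq_or_lt with rfl | hxb
  · simp [payoff]
  · rw [payoff_right_endpoint hxb]
    nlinarith [hx.1]

theorem pos_or_lt_one (ha : 0 ≤ a) (hb : b ≤ 1) (h : (1 - a) * b ≤ 1 / 2) : 0 < a ∨ b < 1 := by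
  by_contra! hc
  nlinarith [hc.1, hc.2, le_antisymm hc.1 ha, le_antisymm hb hc.2]

/-- Best replies to `b` lie in `{a, b}`, and `a` is one only if `(1 - a) * b = 1 / 2`, apart from
the trivial case `a = b`. -/
theorem IsOptimalAgainst.eq_dirac {ν : Measure ℝ} [IsProbabilityMeasure ν] (ha : 0 ≤ a)
    (hab : a ≤ b) (hb : b ≤ 1) (h : (1 - a) * b ≤ 1 / 2)
    (hν : IsOptimalAgainst a b (Measure.dirac b) ν) : ν = Measure.dirac b := by
  refine eq_dirac_of_ae_eq ?_
  rcases hab.eq_or_lt with rfl | hab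
  · exact hν.mem_Icc.mono fun x hx => le_antisymm hx.2 hx.1
  have hbr : ∀ᵐ x ∂ν, meanPayoff (Measure.dirac b) x = 1 / 2 := by
    refine ae_meanPayoff_eq ?_ (hν.mem_Icc.mono fun x hx => Icc_subset_Icc ha hb hx)
      (hν.mem_Icc.mono fun x hx => meanPayoff_dirac_le ha h hx) hν.integral_left
    rw [ae_dirac_eq]
    exact ⟨by linarith, hb⟩
  have hsupp : ∀ᵐ x ∂ν, x = a ∨ x = b := by
    filter_upwards [hbr, hν.mem_Icc] with x h1 h2
    by_contra! hc
    rw [meanPayoff_dirac] at h1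
    exact (payoff_right_endpoint_lt ha h
      ⟨lt_of_le_of_ne h2.1 hc.1.symm, lt_of_le_of_ne h2.2 hc.2⟩).ne h1
  have hna : ∀ᵐ x ∂ν, x ≠ a := by
    rcases h.eq_or_lt with heq | hlt
    · have hG : ∀ t ∈ Ico a b, cdf ν t = ν.real {a} := by
        intro t ht
        rw [cdf_eq_real]
        refine measureReal_congr (hsupp.mono fun x hx => ?_)
        change (x ∈ Iic t) = (x ∈ ({a} : Set ℝ))
        rcases hx with rfl | rfl
        · simp [ht.1]
        · simp [ht.2, hab.ne']
      have hI : ∫ t in a..b, cdf ν t = (b - a) * ν.real {a} := by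
        rw [intervalIntegral.integral_congr_uIoo (g := fun _ => ν.real {a})]
        · simp
        · rw [uIoo_of_le hab.le]
          exact fun t ht => hG t (Ioo_subset_Ico_self ht)
      -- A threshold just above `a` would beat an atom at `a` and earn more than `1 / 2`.
      have hle := limitPayoff_le hν.mem_Icc
        (fun t ht => hν.meanPayoff_le t (Ioo_subset_Icc_self ht) (Or.inr (Or.inr ht)))
        (left_mem_Ico.2 hab)
      rw [limitPayoff, hI, hG a (left_mem_Ico.2 hab), intervalIntegral.integral_same, sqSum] at hle
      have hp : ν.real {a} * (1 / 2 - a + a ^ 2) ≤ 0 := by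
        linear_combination hle - (1 - ν.real {a}) * heq
      have h0 : ν.real {a} = 0 := by
        have h1 : 0 ≤ ν.real {a} := measureReal_nonneg
        nlinarith [sq_nonneg (a - 1 / 2)]
      rw [measureReal_eq_zero_iff] at h0
      exact measure_eq_zero_iff_ae_notMem.1 h0
    · filter_upwards [hbr] with x hx hxa
      rw [meanPayoff_dirac, hxa, payoff_right_endpoint hab] at hx
      linarith
  filter_upwards [hsupp, hna] with x h1 h2
  exact h1.resolve_left h2

end

/-! ### Closed forms for the candidate distribution -/

/-- The distribution function of the equilibrium strategy below the cutoff. -/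
noncomputable def baseCdf (a x : ℝ) : ℝ :=
  1 / (2 * (1 - a)) * ((1 - 2 * a) + √(sqSum a) * ((2 * x - 1) / √(sqSum x)))

/-- The primitive of `baseCdf a` that vanishes at `a`. -/
noncomputable def basePrim (a x : ℝ) : ℝ :=
  ((1 - 2 * a) * x - (1 - a) + √(sqSum a) * √(sqSum x)) / (2 * (1 - a))

theorem sqrt_sqSum_pos (x : ℝ) : 0 < √(sqSum x) := Real.sqrt_pos.2 (sqSum_pos x)

theorem sq_sqrt_sqSum (x : ℝ) : √(sqSum x) ^ 2 = sqSum x := Real.sq_sqrt (sqSum_pos x).le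

theorem hasDerivAt_sqrt_sqSum (x : ℝ) :
    HasDerivAt (fun x => √(sqSum x)) ((2 * x - 1) / √(sqSum x)) x := by
  have h1 : HasDerivAt sqSum (4 * x - 2) x := by
    have h := (((hasDerivAt_id x).const_sub 1).pow 2).add ((hasDerivAt_id x).pow 2)
    refine h.congr_deriv ?_
    simp
    ring
  refine (h1.sqrt (sqSum_pos x).ne').congr_deriv ?_
  rw [div_eq_div_iff (by positivity [sqrt_sqSum_pos x]) (sqrt_sqSum_pos x).ne']
  ring

theorem hasDerivAt_basePrim (a x : ℝ) : HasDerivAt (basePrim a) (baseCdf a x) x := by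
  have h := ((((hasDerivAt_id x).const_mul (1 - 2 * a)).sub_const (1 - a)).add
    ((hasDerivAt_sqrt_sqSum x).const_mul √(sqSum a))).div_const (2 * (1 - a))
  refine h.congr_deriv ?_
  rw [baseCdf, mul_one, div_mul_eq_mul_div, one_mul]

/-- As `2 * sqSum x = 1 + (2 * x - 1) ^ 2`, the quotient `(2 * x - 1) / √(sqSum x)` has derivative
`1 / √(sqSum x) ^ 3`. -/
theorem strictMono_baseCdf {a : ℝ} (ha : a < 1) : StrictMono (baseCdf a) := by
  refine strictMono_of_hasDerivAt_pos (f' := fun x =>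
    1 / (2 * (1 - a)) * (√(sqSum a) * (1 / √(sqSum x) ^ 3))) (fun x => ?_) (fun x => ?_)
  · have h1 : HasDerivAt (fun x : ℝ => 2 * x - 1) 2 x := by
      simpa using ((hasDerivAt_id x).const_mul 2).sub_const 1
    have h := (((h1.div (hasDerivAt_sqrt_sqSum x) (sqrt_sqSum_pos x).ne').const_mul
      √(sqSum a)).const_add (1 - 2 * a)).const_mul (1 / (2 * (1 - a)))
    refine h.congr_deriv ?_
    have hs := sqrt_sqSum_pos x
    have hs2 := sq_sqrt_sqSum x
    congr 2
    field_simp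
    rw [hs2, sqSum]
    ring
  · have := sqrt_sqSum_pos x
    have := sqrt_sqSum_pos a
    have : 0 < 1 - a := by linarith
    positivity

theorem continuous_baseCdf (a : ℝ) : Continuous (baseCdf a) := by
  have hs : Continuous fun x => √(sqSum x) := by unfold sqSum; fun_prop
  unfold baseCdf
  exact continuous_const.mul (continuous_const.add (continuous_const.mul
    ((by fun_prop : Continuous fun x : ℝ => 2 * x - 1).div hs fun x => (sqrt_sqSum_pos x).ne')))

theorem baseCdf_self (a : ℝ) : baseCdf a a = 0 := by
  rw [baseCdf, mul_div_cancel₀ _ (sqrt_sqSum_pos a).ne']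
  ring

theorem basePrim_self (a : ℝ) : basePrim a a = 0 := by
  rw [basePrim, ← sq, sq_sqrt_sqSum, sqSum]
  ring

theorem sqSum_mul_baseCdf (a x : ℝ) : sqSum x * baseCdf a x =
    ((1 - 2 * a) * sqSum x + √(sqSum a) * √(sqSum x) * (2 * x - 1)) / (2 * (1 - a)) := by
  have hs := sqrt_sqSum_pos x
  have e : sqSum x * ((2 * x - 1) / √(sqSum x)) = √(sqSum x) * (2 * x - 1) := by
    nth_rewrite 1 [← sq_sqrt_sqSum x]
    field_simp
  rw [baseCdf, one_div, div_eq_inv_mul]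
  linear_combination (2 * (1 - a))⁻¹ * √(sqSum a) * e

section

variable {a b : ℝ}

/-- Minus the denominator of the cutoff. -/
noncomputable def cutoffDenom (a b : ℝ) : ℝ :=
  4 * (1 - a) * b - 1 - 2 * (1 - 2 * a) * b ^ 2

theorem cutoffDenom_pos (ha : 0 ≤ a) (hb : b ≤ 1) (h : 1 / 2 < (1 - a) * b) :
    0 < cutoffDenom a b := by
  unfold cutoffDenom
  -- `cutoffDenom a b` is twice this product plus `2 * a * b ^ 2 + (1 - b)`.
  have h1 : 0 < (2 - b) * ((1 - a) * b - 1 / 2) := mul_pos (by linarith) (by linarith)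
  have h2 : 0 ≤ a * b ^ 2 := by positivity
  nlinarith

theorem cutoff_mul (h : 0 < cutoffDenom a b) :
    cutoff a b * cutoffDenom a b = -(1 - a - 2 * b + 4 * a * b - 2 * a * b ^ 2) := by
  have e : 1 - 4 * (1 - a) * b + 2 * (1 - 2 * a) * b ^ 2 = -cutoffDenom a b := by
    unfold cutoffDenom; ring
  rw [cutoff, e, div_neg, neg_mul, div_mul_cancel₀ _ h.ne']

theorem pos_and_lt_half (ha : 0 ≤ a) (hab : a ≤ b) (hb : b ≤ 1) (h : 1 / 2 < (1 - a) * b) :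
    0 < b ∧ a < 1 / 2 := by
  constructor <;> nlinarith

theorem lt_cutoff (ha : 0 ≤ a) (hab : a ≤ b) (hb : b ≤ 1) (h : 1 / 2 < (1 - a) * b) :
    a < cutoff a b := by
  have hT := cutoffDenom_pos ha hb h
  have e : (cutoff a b - a) * cutoffDenom a b =
      (2 * ((1 - a) * b) - 1) * (1 - 2 * a + 2 * a * b) := by
    rw [sub_mul, cutoff_mul hT, cutoffDenom]; ring
  obtain ⟨h0, ha1⟩ := pos_and_lt_half ha hab hb h
  have h1 : 0 < (2 * ((1 - a) * b) - 1) * (1 - 2 * a + 2 * a * b) := by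
    exact mul_pos (by linarith) (by nlinarith [mul_nonneg ha h0.le])
  rw [← e] at h1
  linarith [pos_of_mul_pos_left h1 hT.le]

/-- Shows that the gap between the cutoff and `b` closes only for `a = 0`, `b = 1`. -/
theorem sub_cutoff_mul (h : 0 < cutoffDenom a b) :
    (b - cutoff a b) * cutoffDenom a b = sqSum b * ((1 - a) * (1 - b) + a * b) := by
  rw [sub_mul, cutoff_mul h, cutoffDenom, sqSum]; ring

theorem cutoff_le (ha : 0 ≤ a) (hab : a ≤ b) (hb : b ≤ 1) (h : 0 < cutoffDenom a b) :
    cutoff a b ≤ b := by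
  have e := sub_cutoff_mul h
  have h1 : 0 ≤ (1 - a) * (1 - b) + a * b :=
    add_nonneg (mul_nonneg (by linarith) (by linarith)) (mul_nonneg ha (by linarith))
  have h2 : 0 ≤ (b - cutoff a b) * cutoffDenom a b := by
    rw [e]; exact mul_nonneg (sqSum_pos b).le h1
  linarith [nonneg_of_mul_nonneg_left h2 h]

/-- Multiplied by `cutoffDenom a b`, both `1 - κ` and `κ` become polynomials in `a`, `b` whose
squares add up to `sqSum b ^ 2 * sqSum a`. Hence all radicals at the cutoff reduce to `√(sqSum a)`
and cancel. -/
theorem sqrt_sqSum_cutoff (h : 0 < cutoffDenom a b) :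
    √(sqSum (cutoff a b)) = sqSum b * √(sqSum a) / cutoffDenom a b := by
  have h1 := sqSum_pos b
  have h2 := sqrt_sqSum_pos a
  rw [Real.sqrt_eq_iff_mul_self_eq (sqSum_pos _).le (by positivity), ← sq, div_pow, mul_pow,
    sq_sqrt_sqSum, eq_div_iff (by positivity)]
  have e := cutoff_mul h
  have e' : sqSum (cutoff a b) * cutoffDenom a b ^ 2 =
      (cutoffDenom a b - cutoff a b * cutoffDenom a b) ^ 2 +
        (cutoff a b * cutoffDenom a b) ^ 2 := by unfold sqSum; ring
  rw [e', e, cutoffDenom, sqSum, sqSum]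
  ring

theorem massB_mul (ha : a < 1) :
    massB a b * ((1 - a) * sqSum b) = (1 - a) * (1 - b) + a * b := by
  have h1 := sqSum_pos b
  have h2 : 0 < 1 - a := by linarith
  rw [massB, ← sqSum, div_mul_cancel₀ _ (by positivity)]
  ring

theorem massB_nonneg (ha : 0 ≤ a) (ha1 : a < 1) (hab : a ≤ b) (hb : b ≤ 1) : 0 ≤ massB a b := by
  have h1 : 0 ≤ massB a b * ((1 - a) * sqSum b) := by
    rw [massB_mul ha1]
    exact add_nonneg (mul_nonneg (by linarith) (by linarith)) (mul_nonneg ha (by linarith))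
  exact nonneg_of_mul_nonneg_left h1 (mul_pos (by linarith) (sqSum_pos b))

theorem baseCdf_cutoff (ha : a < 1) (h : 0 < cutoffDenom a b) :
    baseCdf a (cutoff a b) = 1 - massB a b := by
  have h1 := sqSum_pos b
  have h2 := sqrt_sqSum_pos a
  have h3 : 0 < 1 - a := by linarith
  have e1 : √(sqSum a) * ((2 * cutoff a b - 1) / √(sqSum (cutoff a b))) =
      (2 * (cutoff a b * cutoffDenom a b) - cutoffDenom a b) / sqSum b := by
    rw [sqrt_sqSum_cutoff h]
    field_simp
  rw [baseCdf, e1, cutoff_mul h, one_div, inv_mul_eq_iff_eq_mul₀ (by positivity),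
    ← eq_sub_iff_add_eq',
    div_eq_iff h1.ne']
  have e2 := massB_mul (b := b) ha
  rw [cutoffDenom]
  rw [sqSum] at *
  linear_combination 2 * e2

/-- The mean of the equilibrium strategy is `1 / (2 * (1 - a))`. -/
theorem basePrim_cutoff_add (ha : a < 1) (h : 0 < cutoffDenom a b) :
    basePrim a (cutoff a b) + (b - cutoff a b) * baseCdf a (cutoff a b) =
      b - 1 / (2 * (1 - a)) := by
  have h1 := sqSum_pos b
  have h2 := sqrt_sqSum_pos a
  have h3 : 0 < 1 - a := by linarith
  have e1 : basePrim a (cutoff a b) = ((1 - 2 * a) * cutoff a b - (1 - a) +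
      sqSum b * sqSum a / cutoffDenom a b) / (2 * (1 - a)) := by
    rw [basePrim, sqrt_sqSum_cutoff h, mul_div_assoc', mul_left_comm, ← sq, sq_sqrt_sqSum]
  have e2 : cutoff a b = -(1 - a - 2 * b + 4 * a * b - 2 * a * b ^ 2) / cutoffDenom a b := by
    rw [eq_div_iff h.ne', cutoff_mul h]
  have e3 : massB a b = ((1 - a) * (1 - b) + a * b) / ((1 - a) * sqSum b) := by
    rw [eq_div_iff (by positivity), massB_mul ha]
  rw [baseCdf_cutoff ha h, e1, e3, e2]
  field_simp
  rw [cutoffDenom, sqSum, sqSum]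
  ring

end

/-! ### The mixed candidate and its payoffs -/

section

variable {a b : ℝ}

/-- The distribution function of the equilibrium strategy when `1 / 2 < (1 - a) * b`. -/
noncomputable def equilibriumCdf (ha : 0 ≤ a) (hab : a ≤ b) (hb : b ≤ 1)
    (h : 1 / 2 < (1 - a) * b) : StieltjesFunction ℝ where
  toFun x := if x < b then baseCdf a (min (max x a) (cutoff a b)) else 1
  mono' := by
    have ha1 : a < 1 := by linarith [pos_and_lt_half ha hab hb h]
    have hm := (strictMono_baseCdf ha1).monotone
    intro x y hxy
    change (if _ then _ else _) ≤ (if _ then _ else _)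
    by_cases hy : y < b
    · rw [if_pos hy, if_pos (hxy.trans_lt hy)]
      exact hm (min_le_min (max_le_max hxy le_rfl) le_rfl)
    rw [if_neg hy]
    split_ifs
    · refine (hm (min_le_right _ _)).trans ?_
      rw [baseCdf_cutoff ha1 (cutoffDenom_pos ha hb h)]
      linarith [massB_nonneg ha ha1 hab hb]
    · exact le_rfl
  right_continuous' x := by
    by_cases hx : x < b
    · have hc : Continuous fun x => baseCdf a (min (max x a) (cutoff a b)) :=
        (continuous_baseCdf a).comp (by fun_prop)
      refine (hc.continuousAt.congr ?_).continuousWithinAt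
      filter_upwards [Iio_mem_nhds hx] with y hy
      exact (if_pos hy).symm
    · exact continuousWithinAt_const.congr
        (fun y hy => if_neg fun h => hx (lt_of_le_of_lt hy h)) (if_neg hx)

variable (ha : 0 ≤ a) (hab : a ≤ b) (hb : b ≤ 1) (h : 1 / 2 < (1 - a) * b)

theorem equilibriumCdf_of_lt {x : ℝ} (hx : x < b) :
    equilibriumCdf ha hab hb h x = baseCdf a (min (max x a) (cutoff a b)) := if_pos hx

theorem equilibriumCdf_of_ge {x : ℝ} (hx : b ≤ x) : equilibriumCdf ha hab hb h x = 1 :=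
  if_neg hx.not_gt

theorem equilibriumCdf_of_le {x : ℝ} (hx : x ≤ a) : equilibriumCdf ha hab hb h x = 0 := by
  have h1 := lt_cutoff ha hab hb h
  have h2 := cutoff_le ha hab hb (cutoffDenom_pos ha hb h)
  rw [equilibriumCdf_of_lt ha hab hb h (by linarith), max_eq_right hx, min_eq_left h1.le,
    baseCdf_self]

theorem leftLim_equilibriumCdf {x : ℝ} (hx : x ≤ b) :
    Function.leftLim (equilibriumCdf ha hab hb h) x = baseCdf a (min (max x a) (cutoff a b)) := by
  have hc : Continuous fun x => baseCdf a (min (max x a) (cutoff a b)) :=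
    (continuous_baseCdf a).comp (by fun_prop)
  refine leftLim_eq_of_tendsto ((hc.continuousAt.mono_left nhdsWithin_le_nhds).congr' ?_)
  filter_upwards [self_mem_nhdsWithin] with y hy
  exact (equilibriumCdf_of_lt ha hab hb h (lt_of_lt_of_le hy hx)).symm

theorem tendsto_equilibriumCdf_atBot :
    Tendsto (equilibriumCdf ha hab hb h) atBot (𝓝 0) := by
  refine tendsto_const_nhds.congr' ?_
  filter_upwards [eventually_le_atBot a] with x hx
  exact (equilibriumCdf_of_le ha hab hb h hx).symm

theorem tendsto_equilibriumCdf_atTop :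
    Tendsto (equilibriumCdf ha hab hb h) atTop (𝓝 1) := by
  refine tendsto_const_nhds.congr' ?_
  filter_upwards [eventually_ge_atTop b] with x hx
  exact (equilibriumCdf_of_ge ha hab hb h hx).symm

/-- The equilibrium strategy when `1 / 2 < (1 - a) * b`. -/
noncomputable def equilibriumStrategy : ProbabilityMeasure ℝ :=
  ⟨(equilibriumCdf ha hab hb h).measure, ⟨by
    rw [StieltjesFunction.measure_univ _ (tendsto_equilibriumCdf_atBot ha hab hb h)
      (tendsto_equilibriumCdf_atTop ha hab hb h), sub_zero, ENNReal.ofReal_one]⟩⟩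

theorem coe_equilibriumStrategy : (equilibriumStrategy ha hab hb h : Measure ℝ) =
    (equilibriumCdf ha hab hb h).measure := rfl

theorem cdf_equilibriumStrategy : cdf (equilibriumStrategy ha hab hb h : Measure ℝ) =
    equilibriumCdf ha hab hb h :=
  cdf_measure_stieltjesFunction _ (tendsto_equilibriumCdf_atBot ha hab hb h)
    (tendsto_equilibriumCdf_atTop ha hab hb h)

theorem equilibriumStrategy_mem : equilibriumStrategy ha hab hb h ∈ strategies (Icc a b) := by
  change (equilibriumStrategy ha hab hb h : Measure ℝ) (Icc a b)ᶜ = 0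
  rw [prob_compl_eq_zero_iff measurableSet_Icc, coe_equilibriumStrategy,
    StieltjesFunction.measure_Icc, leftLim_equilibriumCdf ha hab hb h hab,
    equilibriumCdf_of_ge ha hab hb h le_rfl, max_self, min_eq_left (lt_cutoff ha hab hb h).le,
    baseCdf_self, sub_zero, ENNReal.ofReal_one]

theorem equilibriumStrategy_singleton_of_lt {x : ℝ} (hx : x < b) :
    (equilibriumStrategy ha hab hb h : Measure ℝ) {x} = 0 := by
  rw [coe_equilibriumStrategy, StieltjesFunction.measure_singleton,
    leftLim_equilibriumCdf ha hab hb h hx.le, equilibriumCdf_of_lt ha hab hb h hx, sub_self,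
    ENNReal.ofReal_zero]

theorem cdf_equilibriumStrategy_of_mem_Ico {x : ℝ} (hx : x ∈ Ico a (cutoff a b)) :
    cdf (equilibriumStrategy ha hab hb h : Measure ℝ) x = baseCdf a x := by
  have h2 := cutoff_le ha hab hb (cutoffDenom_pos ha hb h)
  rw [cdf_equilibriumStrategy, equilibriumCdf_of_lt ha hab hb h (by linarith [hx.2]),
    max_eq_left hx.1, min_eq_left hx.2.le]

theorem cdf_equilibriumStrategy_of_cutoff_le {x : ℝ} (hx : cutoff a b ≤ x) (hxb : x < b) :
    cdf (equilibriumStrategy ha hab hb h : Measure ℝ) x = baseCdf a (cutoff a b) := by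
  have h1 := lt_cutoff ha hab hb h
  rw [cdf_equilibriumStrategy, equilibriumCdf_of_lt ha hab hb h hxb,
    max_eq_left (h1.le.trans hx), min_eq_right hx]

theorem equilibriumStrategy_singleton_right :
    (equilibriumStrategy ha hab hb h : Measure ℝ).real {b} = massB a b := by
  have ha1 : a < 1 := by linarith [pos_and_lt_half ha hab hb h]
  have h2 := cutoff_le ha hab hb (cutoffDenom_pos ha hb h)
  rw [coe_equilibriumStrategy, measureReal_def, StieltjesFunction.measure_singleton,
    leftLim_equilibriumCdf ha hab hb h le_rfl, equilibriumCdf_of_ge ha hab hb h le_rfl,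
    max_eq_left hab, min_eq_right h2, baseCdf_cutoff ha1 (cutoffDenom_pos ha hb h), sub_sub_cancel,
    ENNReal.toReal_ofReal (massB_nonneg ha ha1 hab hb)]

theorem integral_cdf_equilibriumStrategy {x : ℝ} (hx : x ∈ Icc a (cutoff a b)) :
    ∫ t in a..x, cdf (equilibriumStrategy ha hab hb h : Measure ℝ) t = basePrim a x := by
  rw [intervalIntegral.integral_congr_Ioo_of_le (g := baseCdf a) hx.1,
    intervalIntegral.integral_eq_sub_of_hasDerivAt
    (fun t _ => hasDerivAt_basePrim a t) ((continuous_baseCdf a).intervalIntegrable _ _),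
    basePrim_self, sub_zero]
  exact fun t ht => cdf_equilibriumStrategy_of_mem_Ico ha hab hb h ⟨ht.1.le, ht.2.trans_le hx.2⟩

theorem integral_cdf_equilibriumStrategy_of_cutoff_le {x : ℝ} (hx : x ∈ Icc (cutoff a b) b) :
    ∫ t in a..x, cdf (equilibriumStrategy ha hab hb h : Measure ℝ) t =
      basePrim a (cutoff a b) + (x - cutoff a b) * baseCdf a (cutoff a b) := by
  rw [← intervalIntegral.integral_add_adjacent_intervals (intervalIntegrable_cdf _ a (cutoff a b))
    (intervalIntegrable_cdf _ (cutoff a b) x), integral_cdf_equilibriumStrategy ha hab hb h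
      (right_mem_Icc.2 (lt_cutoff ha hab hb h).le), intervalIntegral.integral_congr_Ioo_of_le
      (g := fun _ => baseCdf a (cutoff a b)) hx.1, intervalIntegral.integral_const, smul_eq_mul]
  exact fun t ht => cdf_equilibriumStrategy_of_cutoff_le ha hab hb h ht.1.le (ht.2.trans_le hx.2)

theorem mean_equilibriumStrategy :
    b - ∫ t in a..b, cdf (equilibriumStrategy ha hab hb h : Measure ℝ) t = 1 / (2 * (1 - a)) := by
  have ha1 : a < 1 := by linarith [pos_and_lt_half ha hab hb h]
  have hT := cutoffDenom_pos ha hb h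
  rw [integral_cdf_equilibriumStrategy_of_cutoff_le ha hab hb h
    (right_mem_Icc.2 (cutoff_le ha hab hb hT)), basePrim_cutoff_add ha1 hT, sub_sub_cancel]

/-- Indifference below the cutoff. -/
theorem base_indifference (ha1 : a < 1) (x : ℝ) :
    (1 - x) * (1 / (2 * (1 - a))) + sqSum x * baseCdf a x - (2 * x - 1) * basePrim a x = 1 / 2 := by
  have h3 : 0 < 1 - a := by linarith
  rw [sqSum_mul_baseCdf, basePrim]
  field_simp
  rw [sqSum]
  ring

theorem meanPayoff_equilibriumStrategy {x : ℝ} (hx : x ∈ Ico a (cutoff a b)) :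
    meanPayoff (equilibriumStrategy ha hab hb h : Measure ℝ) x = 1 / 2 := by
  have ha1 : a < 1 := by linarith [pos_and_lt_half ha hab hb h]
  have h2 := cutoff_le ha hab hb (cutoffDenom_pos ha hb h)
  rw [meanPayoff_eq hab (ae_mem_of_mem_strategies (equilibriumStrategy_mem ha hab hb h)) hx.1,
    measureReal_def, equilibriumStrategy_singleton_of_lt ha hab hb h (by linarith [hx.2]),
    limitPayoff, mean_equilibriumStrategy,
    integral_cdf_equilibriumStrategy ha hab hb h (Ico_subset_Icc_self hx),
    cdf_equilibriumStrategy_of_mem_Ico ha hab hb h hx, base_indifference ha1]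
  simp

/-- The strategy has no mass in `[κ, b)`, and against a fixed rival threshold the payoff is affine
on either side of it. So the payoff is affine here, starting from indifference at `κ`. -/
theorem meanPayoff_equilibriumStrategy_of_cutoff_le {x : ℝ} (hx : x ∈ Ico (cutoff a b) b) :
    meanPayoff (equilibriumStrategy ha hab hb h : Measure ℝ) x =
      1 / 2 - (x - cutoff a b) * (cutoffDenom a b / (2 * (1 - a) * sqSum b)) := by
  have ha1 : a < 1 := by linarith [pos_and_lt_half ha hab hb h]
  have h3 : 0 < 1 - a := by linarith
  have hT := cutoffDenom_pos ha hb h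
  have hκ := lt_cutoff ha hab hb h
  have hκb := hx.1.trans_lt hx.2
  have hg := sqSum_pos b
  rw [meanPayoff_eq hab (ae_mem_of_mem_strategies (equilibriumStrategy_mem ha hab hb h))
    (hκ.le.trans hx.1), measureReal_def, equilibriumStrategy_singleton_of_lt ha hab hb h hx.2,
    limitPayoff, mean_equilibriumStrategy,
    integral_cdf_equilibriumStrategy_of_cutoff_le ha hab hb h (Ico_subset_Icc_self hx),
    cdf_equilibriumStrategy_of_cutoff_le ha hab hb h hx.1 hx.2, ENNReal.toReal_zero, mul_zero,
    sub_zero]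
  have e1 := base_indifference ha1 (cutoff a b)
  have e2 := basePrim_cutoff_add ha1 hT
  have e3 : massB a b = ((1 - a) * (1 - b) + a * b) / ((1 - a) * sqSum b) := by
    rw [eq_div_iff (by positivity), massB_mul ha1]
  -- The left side is the slope in `x`: `y - 1` averaged over the part below the cutoff, and `-b` on
  -- the atom.
  have e4 : 1 / (2 * (1 - a)) - 1 - (2 * b - 1) * massB a b =
      -(cutoffDenom a b / (2 * (1 - a) * sqSum b)) := by
    rw [e3]
    field_simp
    rw [cutoffDenom, sqSum]
    ring
  rw [baseCdf_cutoff ha1 hT] at e1 e2 ⊢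
  rw [sqSum] at e1 ⊢
  linear_combination e1 - 2 * (x - cutoff a b) * e2 + (x - cutoff a b) * e4

theorem meanPayoff_equilibriumStrategy_right :
    meanPayoff (equilibriumStrategy ha hab hb h : Measure ℝ) b = 1 / 2 := by
  have ha1 : a < 1 := by linarith [pos_and_lt_half ha hab hb h]
  have h3 : 0 < 1 - a := by linarith
  have hm := mean_equilibriumStrategy ha hab hb h
  rw [meanPayoff_eq hab (ae_mem_of_mem_strategies (equilibriumStrategy_mem ha hab hb h)) hab,
    equilibriumStrategy_singleton_right, limitPayoff, mean_equilibriumStrategy,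
    cdf_equilibriumStrategy, equilibriumCdf_of_ge ha hab hb h le_rfl,
    show ∫ t in a..b, equilibriumCdf ha hab hb h t = b - 1 / (2 * (1 - a)) by
      rw [cdf_equilibriumStrategy] at hm; linarith]
  have e4 := massB_mul (b := b) ha1
  have e5 : massB a b * sqSum b = ((1 - a) * (1 - b) + a * b) / (1 - a) := by
    rw [eq_div_iff h3.ne']; linarith
  rw [div_mul_eq_mul_div, mul_comm _ (massB a b), e5, sqSum]
  field_simp
  ring

theorem meanPayoff_equilibriumStrategy_lt {x : ℝ} (hx : x ∈ Ioo (cutoff a b) b) :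
    meanPayoff (equilibriumStrategy ha hab hb h : Measure ℝ) x < 1 / 2 := by
  have ha1 : a < 1 := by linarith [pos_and_lt_half ha hab hb h]
  rw [meanPayoff_equilibriumStrategy_of_cutoff_le ha hab hb h (Ioo_subset_Ico_self hx)]
  have : 0 < cutoffDenom a b / (2 * (1 - a) * sqSum b) :=
    div_pos (cutoffDenom_pos ha hb h) (mul_pos (by linarith) (sqSum_pos b))
  have := mul_pos (sub_pos.2 hx.1) this
  linarith

theorem meanPayoff_equilibriumStrategy_le {x : ℝ} (hx : x ∈ Icc a b) :
    meanPayoff (equilibriumStrategy ha hab hb h : Measure ℝ) x ≤ 1 / 2 := by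
  rcases hx.2.eq_or_lt with rfl | hxb
  · exact (meanPayoff_equilibriumStrategy_right ha hab hb h).le
  rcases lt_or_ge x (cutoff a b) with h1 | h1
  · exact (meanPayoff_equilibriumStrategy ha hab hb h ⟨hx.1, h1⟩).le
  rcases h1.eq_or_lt with h1 | h1
  · rw [meanPayoff_equilibriumStrategy_of_cutoff_le ha hab hb h ⟨h1.le, hxb⟩, h1]
    simp
  · exact (meanPayoff_equilibriumStrategy_lt ha hab hb h ⟨h1, hxb⟩).le

theorem avoidsTrivial_equilibriumStrategy :
    AvoidsTrivial a b (equilibriumStrategy ha hab hb h : Measure ℝ) := by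
  rcases ha.eq_or_lt with rfl | h0
  swap
  · exact Or.inl h0
  rcases hb.eq_or_lt with rfl | h1
  swap
  · exact Or.inr (Or.inl h1)
  refine Or.inr (Or.inr ?_)
  -- Now `a = 0` and `b = 1`: there is no atom at `0`, and `massB 0 1 = 0`.
  have e0 := equilibriumStrategy_singleton_of_lt ha hab hb h zero_lt_one
  have e1 := equilibriumStrategy_singleton_right ha hab hb h
  rw [massB] at e1
  norm_num at e1
  filter_upwards [measure_eq_zero_iff_ae_notMem.1 e0,
    measure_eq_zero_iff_ae_notMem.1 e1] with x h1 h2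
  exact ⟨h1, h2⟩

end

/-! ### Uniqueness in the mixed case -/

section

variable {a b : ℝ} (ha : 0 ≤ a) (hab : a ≤ b) (hb : b ≤ 1) (h : 1 / 2 < (1 - a) * b)
  {ν : Measure ℝ} [IsProbabilityMeasure ν]

/-- Excess of the mean of the equilibrium strategy over the mean of `ν`. -/
noncomputable def meanGap (a b : ℝ) (ν : Measure ℝ) : ℝ :=
  1 / (2 * (1 - a)) - (b - ∫ t in a..b, cdf ν t)

/-- Difference of the integrated distribution functions of `ν` and of the equilibrium strategy,
below the cutoff. -/
noncomputable def primGap (a : ℝ) (ν : Measure ℝ) (x : ℝ) : ℝ :=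
  (∫ t in a..x, cdf ν t) - basePrim a x

theorem IsOptimalAgainst.ae_meanPayoff_eq_half
    (hν : IsOptimalAgainst a b (equilibriumStrategy ha hab hb h : Measure ℝ) ν) :
    ∀ᵐ x ∂(equilibriumStrategy ha hab hb h : Measure ℝ), meanPayoff ν x = 1 / 2 := by
  have hμ := ae_mem_of_mem_strategies (equilibriumStrategy_mem ha hab hb h)
  refine ae_meanPayoff_eq (hν.mem_Icc.mono fun x hx => Icc_subset_Icc ha hb hx)
    (hμ.mono fun x hx => Icc_subset_Icc ha hb hx) ?_ hν.integral_right
  by_cases h0 : 0 < a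
  · exact hμ.mono fun x hx => hν.meanPayoff_le x hx (Or.inl h0)
  by_cases h1 : b < 1
  · exact hμ.mono fun x hx => hν.meanPayoff_le x hx (Or.inr (Or.inl h1))
  have hav := avoidsTrivial_equilibriumStrategy ha hab hb h
  simp only [AvoidsTrivial, h0, h1, false_or] at hav
  filter_upwards [hμ, hav] with x hx hx'
  refine hν.meanPayoff_le x hx (Or.inr (Or.inr ⟨lt_of_le_of_ne hx.1 ?_, lt_of_le_of_ne hx.2 ?_⟩))
  · intro e; exact hx'.1 (by linarith)
  · intro e; exact hx'.2 (by linarith)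

/-- The equilibrium strategy charges every interval to the right of `x`, its cdf being strictly
increasing there. Thus exact best replies to `ν` accumulate at `x` from above. -/
theorem IsOptimalAgainst.limitPayoff_eq_half
    (hν : IsOptimalAgainst a b (equilibriumStrategy ha hab hb h : Measure ℝ) ν)
    {x : ℝ} (hx : x ∈ Ico a (cutoff a b)) :
    limitPayoff a b ν x = 1 / 2 := by
  have ha1 : a < 1 := by linarith [pos_and_lt_half ha hab hb h]
  have hκb := cutoff_le ha hab hb (cutoffDenom_pos ha hb h)
  refine limitPayoff_eq hν.mem_Icc ⟨hx.1, hx.2.trans_le hκb⟩ fun hne => ?_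
  obtain ⟨c, hc, hsub⟩ := (mem_nhdsGT_iff_exists_Ioo_subset' hx.2).1 hne
  obtain ⟨m, hxm, hm⟩ := exists_between (lt_min hc hx.2)
  have h0 : (equilibriumStrategy ha hab hb h : Measure ℝ) (Ioc x m) = 0 := by
    refine measure_mono_null ?_ (hν.ae_meanPayoff_eq_half ha hab hb h)
    exact fun t ht => hsub ⟨ht.1, ht.2.trans_lt (hm.trans_le (min_le_left _ _))⟩
  rw [coe_equilibriumStrategy, StieltjesFunction.measure_Ioc, ENNReal.ofReal_eq_zero,
    ← cdf_equilibriumStrategy, cdf_equilibriumStrategy_of_mem_Ico ha hab hb h hx,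
    cdf_equilibriumStrategy_of_mem_Ico ha hab hb h
      ⟨hx.1.trans hxm.le, hm.trans_le (min_le_right _ _)⟩] at h0
  linarith [strictMono_baseCdf ha1 hxm]

theorem IsOptimalAgainst.sqSum_mul_sub
    (hν : IsOptimalAgainst a b (equilibriumStrategy ha hab hb h : Measure ℝ) ν)
    {x : ℝ} (hx : x ∈ Ico a (cutoff a b)) :
    sqSum x * (cdf ν x - baseCdf a x) =
      (2 * x - 1) * primGap a ν x + (1 - x) * meanGap a b ν := by
  have ha1 : a < 1 := by linarith [pos_and_lt_half ha hab hb h]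
  have e1 := hν.limitPayoff_eq_half ha hab hb h hx
  have e2 := base_indifference ha1 x
  rw [limitPayoff] at e1
  rw [primGap, meanGap]
  linear_combination e1 - e2

theorem IsOptimalAgainst.primGap_eq
    (hν : IsOptimalAgainst a b (equilibriumStrategy ha hab hb h : Measure ℝ) ν)
    {x : ℝ} (hx : x ∈ Icc a (cutoff a b)) :
    primGap a ν x = meanGap a b ν * (x - a * (√(sqSum x) / √(sqSum a))) := by
  have hP : Continuous (basePrim a) :=
    continuous_iff_continuousAt.2 fun x => (hasDerivAt_basePrim a x).continuousAt
  have hs : Continuous fun x => √(sqSum x) :=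
    continuous_iff_continuousAt.2 fun x => (hasDerivAt_sqrt_sqSum x).continuousAt
  -- In the ODE of `sqSum_mul_sub`, `meanGap a b ν * x` is a particular solution and `√(sqSum x)`
  -- the homogeneous one. Right derivatives are used because `cdf ν` is only right continuous.
  have key := constant_of_has_deriv_right_zero
    (f := fun x => (primGap a ν x - meanGap a b ν * x) / √(sqSum x)) (a := a) (b := cutoff a b)
    ((((continuous_integral_cdf ν a).sub hP).sub (continuous_const.mul continuous_id)).div hs
      fun x => (sqrt_sqSum_pos x).ne').continuousOn ?_ x hx
  · have h1 := sqrt_sqSum_pos x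
    have h2 := sqrt_sqSum_pos a
    have h3 : primGap a ν a = 0 := by simp [primGap, basePrim_self]
    simp only [h3] at key
    field_simp at key ⊢
    linear_combination key
  · intro t ht
    have d1 : HasDerivWithinAt (fun x => ∫ t in a..x, cdf ν t) (cdf ν t) (Ici t) t :=
      intervalIntegral.integral_hasDerivWithinAt_right (t := Ioi t) (intervalIntegrable_cdf ν a t)
        (monotone_cdf ν).measurable.stronglyMeasurable.stronglyMeasurableAtFilter
        (((cdf ν).right_continuous t).mono Ioi_subset_Ici_self)
    have d2 := ((d1.sub (hasDerivAt_basePrim a t).hasDerivWithinAt).sub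
      ((hasDerivWithinAt_id t _).const_mul (meanGap a b ν))).div
      (hasDerivAt_sqrt_sqSum t).hasDerivWithinAt (sqrt_sqSum_pos t).ne'
    refine d2.congr_deriv ?_
    have h1 := sqrt_sqSum_pos t
    have e := hν.sqSum_mul_sub ha hab hb h ht
    rw [div_eq_zero_iff]
    left
    have e2 := sq_sqrt_sqSum t
    rw [sub_eq_zero, mul_div_assoc', eq_div_iff h1.ne']
    change (cdf ν t - baseCdf a t - meanGap a b ν * 1) * √(sqSum t) * √(sqSum t) =
      (primGap a ν t - meanGap a b ν * t) * (2 * t - 1)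
    rw [mul_assoc, ← sq, e2]
    have e3 : sqSum t - t * (2 * t - 1) = 1 - t := by rw [sqSum]; ring
    linear_combination e - meanGap a b ν * e3

/-- Thresholds strictly between the cutoff and `b` are not best replies to the equilibrium strategy,
so `ν` does not charge them. -/
theorem IsOptimalAgainst.cdf_eq_of_cutoff_le
    (hν : IsOptimalAgainst a b (equilibriumStrategy ha hab hb h : Measure ℝ) ν)
    {x : ℝ} (hx : x ∈ Ico (cutoff a b) b) :
    cdf ν x = cdf ν (cutoff a b) := by
  have hμ := ae_mem_of_mem_strategies (equilibriumStrategy_mem ha hab hb h)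
  have hbr := ae_meanPayoff_eq (hμ.mono fun x hx => Icc_subset_Icc ha hb hx)
    (hν.mem_Icc.mono fun x hx => Icc_subset_Icc ha hb hx)
    (hν.mem_Icc.mono fun x hx => meanPayoff_equilibriumStrategy_le ha hab hb h hx) hν.integral_left
  rw [cdf_eq_real, cdf_eq_real]
  refine measureReal_congr (hbr.mono fun y hy => propext ⟨fun hyx => ?_, fun hyx => ?_⟩)
  · by_contra hc
    exact (meanPayoff_equilibriumStrategy_lt ha hab hb h
      ⟨not_le.1 hc, lt_of_le_of_lt hyx hx.2⟩).ne hy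
  · exact le_trans hyx hx.1

theorem IsOptimalAgainst.meanGap_eq
    (hν : IsOptimalAgainst a b (equilibriumStrategy ha hab hb h : Measure ℝ) ν) :
    meanGap a b ν =
    primGap a ν (cutoff a b) + (b - cutoff a b) * (cdf ν (cutoff a b) - baseCdf a (cutoff a b)) := by
  have ha1 : a < 1 := by linarith [pos_and_lt_half ha hab hb h]
  have hT := cutoffDenom_pos ha hb h
  have hκb := cutoff_le ha hab hb hT
  have e1 := basePrim_cutoff_add ha1 hT
  have e2 : ∫ t in (cutoff a b)..b, cdf ν t = (b - cutoff a b) * cdf ν (cutoff a b) := by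
    rw [intervalIntegral.integral_congr_Ioo_of_le (g := fun _ => cdf ν (cutoff a b)) hκb,
      intervalIntegral.integral_const, smul_eq_mul]
    exact fun t ht => hν.cdf_eq_of_cutoff_le ha hab hb h (Ioo_subset_Ico_self ht)
  have e3 := intervalIntegral.integral_add_adjacent_intervals
    (intervalIntegrable_cdf ν a (cutoff a b)) (intervalIntegrable_cdf ν (cutoff a b) b)
  rw [meanGap, primGap]
  linarith

/-- At `x = a` the ODE reads `sqSum a * cdf ν a = (1 - a) * meanGap a b ν`. -/
theorem IsOptimalAgainst.meanGap_nonneg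
    (hν : IsOptimalAgainst a b (equilibriumStrategy ha hab hb h : Measure ℝ) ν) :
    0 ≤ meanGap a b ν := by
  have ha1 : a < 1 := by linarith [pos_and_lt_half ha hab hb h]
  have e := hν.sqSum_mul_sub ha hab hb h (left_mem_Ico.2 (lt_cutoff ha hab hb h))
  have h3 : primGap a ν a = 0 := by simp [primGap, basePrim_self]
  rw [h3, baseCdf_self, mul_zero, zero_add, sub_zero] at e
  have h4 : 0 ≤ (1 - a) * meanGap a b ν := by
    rw [← e]; exact mul_nonneg (sqSum_pos a).le (cdf_nonneg ν a)
  exact nonneg_of_mul_nonneg_right h4 (by linarith)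

theorem IsOptimalAgainst.meanGap_nonpos
    (hν : IsOptimalAgainst a b (equilibriumStrategy ha hab hb h : Measure ℝ) ν) :
    meanGap a b ν ≤ 0 := by
  have ha1 : a < 1 := by linarith [pos_and_lt_half ha hab hb h]
  have hT := cutoffDenom_pos ha hb h
  have hκ := lt_cutoff ha hab hb h
  have hκb := cutoff_le ha hab hb hT
  have hg := sqSum_pos (cutoff a b)
  by_contra! hn
  -- Outside the case `a = 0`, `b = 1` the gap is nonempty, so the payoff just above the cutoff is
  -- constrained.
  by_cases hc : 0 < a ∨ b < 1
  · have hκb' : cutoff a b < b := by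
      have e := sub_cutoff_mul hT
      have h1 : 0 < (1 - a) * (1 - b) + a * b := by
        rcases hc with hc | hc
        · exact add_pos_of_nonneg_of_pos (mul_nonneg (by linarith) (by linarith))
            (mul_pos hc (hc.trans_le hab))
        · exact add_pos_of_pos_of_nonneg (mul_pos (by linarith) (by linarith))
            (mul_nonneg ha (ha.trans hab))
      have h2 : 0 < (b - cutoff a b) * cutoffDenom a b := by
        rw [e]; exact mul_pos (sqSum_pos b) h1
      linarith [pos_of_mul_pos_left h2 hT.le]
    have hle := limitPayoff_le hν.mem_Icc
      (fun t ht => hν.meanPayoff_le t (Ioo_subset_Icc_self ht) (Or.inr (Or.inr ht)))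
      ⟨hκ.le, hκb'⟩
    have hD : sqSum (cutoff a b) * (cdf ν (cutoff a b) - baseCdf a (cutoff a b)) ≤
        (2 * cutoff a b - 1) * primGap a ν (cutoff a b) + (1 - cutoff a b) * meanGap a b ν := by
      have e2 := base_indifference ha1 (cutoff a b)
      rw [limitPayoff] at hle
      rw [primGap, meanGap]
      linear_combination hle - e2
    have e1 := hν.meanGap_eq ha hab hb h
    have e2 := hν.primGap_eq ha hab hb h (right_mem_Icc.2 hκ.le)
    generalize meanGap a b ν = n at *
    generalize primGap a ν (cutoff a b) = J at *
    generalize cdf ν (cutoff a b) - baseCdf a (cutoff a b) = D at *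
    have hr : 0 < √(sqSum (cutoff a b)) / √(sqSum a) :=
      div_pos (sqrt_sqSum_pos _) (sqrt_sqSum_pos _)
    generalize √(sqSum (cutoff a b)) / √(sqSum a) = ρ at *
    generalize cutoff a b = κ at *
    have h1 := mul_le_mul_of_nonneg_left hD (sub_pos.2 hκb').le
    have hκ0 : 0 < κ := ha.trans_lt hκ
    -- Eliminates `D` through `(b - κ) * D = n - J` and then `J` through the solution of the ODE;
    -- the factor of `n` turns out positive.
    have key : n * ((1 - b) * sqSum κ + a * ρ * ((1 - κ) * (1 - b) + κ * b)) ≤ 0 := by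
      subst e2
      rw [sqSum] at *
      linear_combination h1 + ((1 - κ) ^ 2 + κ ^ 2) * e1
    have hdot : 0 ≤ (1 - κ) * (1 - b) := mul_nonneg (by linarith) (by linarith)
    have hκb2 : 0 < κ * b := mul_pos hκ0 (hκ0.trans hκb')
    have hpos : 0 < (1 - b) * sqSum κ + a * ρ * ((1 - κ) * (1 - b) + κ * b) := by
      rcases hc with hc | hc
      · exact add_pos_of_nonneg_of_pos (mul_nonneg (by linarith) hg.le)
          (mul_pos (mul_pos hc hr) (by linarith))
      · exact add_pos_of_pos_of_nonneg (mul_pos (by linarith) hg)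
          (mul_nonneg (mul_nonneg ha hr.le) (by linarith))
    linarith [mul_pos hn hpos]
  -- There is no gap here. The ODE solution makes `cdf ν - baseCdf 0` equal to the constant `meanGap
  -- 0 1 ν` on `(0, 1)`; since `baseCdf 0` tends to `1` at `1`, a positive constant would push `cdf
  -- ν` above `1`.
  · push Not at hc
    obtain rfl : a = 0 := le_antisymm hc.1 ha
    obtain rfl : b = 1 := le_antisymm hb hc.2
    have hκ1 : cutoff 0 1 = 1 := by norm_num [cutoff]
    have h1 : ∀ x ∈ Ioo (0 : ℝ) 1, baseCdf 0 x ≤ 1 - meanGap 0 1 ν := by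
      intro x hx
      have hx' : x ∈ Ico 0 (cutoff 0 1) := by rw [hκ1]; exact Ioo_subset_Ico_self hx
      have e1 := hν.sqSum_mul_sub ha hab hb h hx'
      rw [hν.primGap_eq ha hab hb h (Ico_subset_Icc_self hx')] at e1
      have e2 : sqSum x * (cdf ν x - baseCdf 0 x - meanGap 0 1 ν) = 0 := by
        rw [mul_sub, e1, sqSum]; ring
      have e3 := (mul_eq_zero.1 e2).resolve_left (sqSum_pos x).ne'
      linarith [cdf_le_one ν x]
    have h2 : baseCdf 0 1 ≤ 1 - meanGap 0 1 ν := by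
      refine le_of_tendsto ((continuous_baseCdf 0).continuousAt.mono_left
        (nhdsWithin_le_nhds (s := Iio 1))) ?_
      filter_upwards [Ioo_mem_nhdsLT zero_lt_one] with x hx using h1 x hx
    have h3 : baseCdf 0 1 = 1 := by norm_num [baseCdf, sqSum]
    linarith

theorem IsOptimalAgainst.eq_equilibriumStrategy
    (hν : IsOptimalAgainst a b (equilibriumStrategy ha hab hb h : Measure ℝ) ν) :
    ν = (equilibriumStrategy ha hab hb h : Measure ℝ) := by
  have ha1 : a < 1 := by linarith [pos_and_lt_half ha hab hb h]
  have hκ := lt_cutoff ha hab hb h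
  have hn : meanGap a b ν = 0 :=
    le_antisymm (hν.meanGap_nonpos ha hab hb h) (hν.meanGap_nonneg ha hab hb h)
  have hJ : ∀ x ∈ Icc a (cutoff a b), primGap a ν x = 0 := fun x hx => by
    rw [hν.primGap_eq ha hab hb h hx, hn, zero_mul]
  refine Measure.eq_of_cdf _ _ (StieltjesFunction.ext fun x => ?_)
  rcases lt_or_ge x a with hxa | hxa
  · rw [cdf_equilibriumStrategy, equilibriumCdf_of_le ha hab hb h hxa.le, cdf_eq_real,
      measureReal_eq_zero_iff, measure_eq_zero_iff_ae_notMem]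
    exact hν.mem_Icc.mono fun y hy hyx => absurd (hy.1.trans hyx) (not_le.2 hxa)
  rcases lt_or_ge x (cutoff a b) with hxκ | hxκ
  · have e := hν.sqSum_mul_sub ha hab hb h ⟨hxa, hxκ⟩
    rw [hJ x ⟨hxa, hxκ.le⟩, hn, mul_zero, mul_zero, add_zero] at e
    rw [cdf_equilibriumStrategy_of_mem_Ico ha hab hb h ⟨hxa, hxκ⟩]
    linarith [(mul_eq_zero.1 e).resolve_left (sqSum_pos x).ne']
  rcases lt_or_ge x b with hxb | hxb
  · have e := hν.meanGap_eq ha hab hb h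
    rw [hn, hJ _ (right_mem_Icc.2 hκ.le), zero_add, eq_comm] at e
    rw [cdf_equilibriumStrategy_of_cutoff_le ha hab hb h hxκ hxb,
      hν.cdf_eq_of_cutoff_le ha hab hb h ⟨hxκ, hxb⟩]
    linarith [(mul_eq_zero.1 e).resolve_left (by linarith : b - cutoff a b ≠ 0)]
  · rw [cdf_equilibriumStrategy, equilibriumCdf_of_ge ha hab hb h hxb, cdf_eq_real,
      measureReal_congr (s := Iic x) (t := univ)
        (hν.mem_Icc.mono fun y hy => eq_true (hy.2.trans hxb)),
      probReal_univ]

end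

end ThresholdTests

theorem mainTheorem5 (r : ThresholdTests.SelectionRule) (hr : ThresholdTests.IsRational r)
    (a b : ℝ) (ha : 0 ≤ a) (hab : a ≤ b) (hb : b ≤ 1) :
    ∃ μ : ProbabilityMeasure ℝ,
      (∀ μX μY : ProbabilityMeasure ℝ,
        ThresholdTests.IsEquilibrium r (Icc a b) μX μY ↔ μX = μ ∧ μY = μ) ∧
      ((1 - a) * b ≤ 1 / 2 → (μ : Measure ℝ) = Measure.dirac b) ∧
      (1 / 2 < (1 - a) * b →
        (a < ThresholdTests.cutoff a b ∧ ThresholdTests.cutoff a b ≤ b) ∧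
        (∀ θ, a ≤ θ → θ < ThresholdTests.cutoff a b →
          ProbabilityTheory.cdf (μ : Measure ℝ) θ =
            1 / (2 * (1 - a)) *
              ((1 - 2 * a) + √(a ^ 2 + (1 - a) ^ 2) *
                ((2 * θ - 1) / √(θ ^ 2 + (1 - θ) ^ 2)))) ∧
        (∀ θ, ThresholdTests.cutoff a b ≤ θ → θ < b →
          ProbabilityTheory.cdf (μ : Measure ℝ) θ = 1 - ThresholdTests.massB a b) ∧
        ProbabilityTheory.cdf (μ : Measure ℝ) b = 1 ∧
        (μ : Measure ℝ).real {b} = ThresholdTests.massB a b) := by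
  open ThresholdTests in
  rcases le_or_gt ((1 - a) * b) (1 / 2) with h | h
  · refine ⟨ThresholdTests.pure b, fun μX μY => isEquilibrium_iff hr ha hb
      (pure_mem_strategies measurableSet_Icc (right_mem_Icc.2 hab))
      (fun x hx => meanPayoff_dirac_le ha h hx)
      ((pos_or_lt_one ha hb h).imp_right Or.inl)
      (fun ν hν => Subtype.ext
        (IsOptimalAgainst.eq_dirac (ν := (ν : Measure ℝ)) ha hab hb h hν)), fun _ => rfl, fun h' => ?_⟩
    exact absurd h h'.not_ge
  · have ha1 : a < 1 := by linarith [pos_and_lt_half ha hab hb h]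
    have hT := cutoffDenom_pos ha hb h
    refine ⟨equilibriumStrategy ha hab hb h, fun μX μY => isEquilibrium_iff hr ha hb
      (equilibriumStrategy_mem ha hab hb h)
      (fun x hx => meanPayoff_equilibriumStrategy_le ha hab hb h hx)
      (avoidsTrivial_equilibriumStrategy ha hab hb h)
      (fun ν hν => Subtype.ext (hν.eq_equilibriumStrategy ha hab hb h)),
      fun h' => absurd h h'.not_gt, fun _ => ⟨⟨lt_cutoff ha hab hb h, cutoff_le ha hab hb hT⟩,
      fun θ h1 h2 => ?_, fun θ h1 h2 => ?_, ?_, equilibriumStrategy_singleton_right ha hab hb h⟩⟩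
    · rw [cdf_equilibriumStrategy_of_mem_Ico ha hab hb h ⟨h1, h2⟩, baseCdf, sqSum, sqSum,
        add_comm (a ^ 2), add_comm (θ ^ 2)]
    · rw [cdf_equilibriumStrategy_of_cutoff_le ha hab hb h h1 h2, baseCdf_cutoff ha1 hT]
    · rw [cdf_equilibriumStrategy, equilibriumCdf_of_ge ha hab hb h le_rfl]
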